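/- Let $p$ be a prime number and let $\mathcal{A}=\mathbb{Z}[S,T,U,V]/(S^p-1,T^p-1,U^p-1,V^p-1)$. The scheme $\mathrm{Hom}_{\mathbb{Z}}((\mathbb{Z}/p\mathbb{Z})^2,\mu_p\times\mu_p)$, whose points over a commutative ring $R$ are the homomorphisms of $R$-group schemes from the constant group scheme $(\mathbb{Z}/p\mathbb{Z})^2$ to $\mu_p\times\mu_p$, is $\mathrm{Spec}(\mathcal{A})$; the universal homomorphism is $h=\begin{pmatrix}S&T\\U&V\end{pmatrix}$, that is, $h(i,j)=(S^iU^j,\,T^iV^j)$. Put $\Phi_p(X)=1+X+\dots+X^{p-1}$. Let $\mathrm{Hom}^{\mathrm{full}}\subset \mathrm{Spec}(\mathcal{A})$ be the closed subscheme defined by the ideal generated by the elements $$\Phi_p(S^aU^b)\,\Phi_p(T^aV^b)\quad\text{and}\quad \Phi_p(S^aT^b)\,\Phi_p(U^aV^b),\qquad (a,b)\in(\mathbb{Z}/p\mathbb{Z})^2\setminus\{(0,0)\}.$$ A morphism $\phi\colon Z'\to Z$ of finite locally free schemes over a base $S$ is called a $\times$-homomorphism (Katz--Mazur) if for every $\mathrm{Spec}(R')\to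 S$ and every $f\in H^0(Z_{R'},\mathcal{O})$ one has $\det(T-f)=\det(T-\phi^*f)$ in $R'[T]$, where $f$ and $\phi^*f$ act by multiplication on the $R'$-modules $H^0(Z_{R'},\mathcal{O})$ and $H^0(Z'_{R'},\mathcal{O})$. Let $\mathrm{Hom}^{\mathrm{KMD}}\subset \mathrm{Spec}(\mathcal{A})$ be the closed subscheme cut out by the conditions that both $h$ and its Cartier dual $h^\vee\colon(\mu_p\times\mu_p)^\vee\to((\mathbb{Z}/p\mathbb{Z})^2)^\vee$ are $\times$-homomorphisms; that is, a ring homomorphism $\mathcal{A}\to R$ gives a point of $\mathrm{Hom}^{\mathrm{KMD}}$ if and only if the base changes of $h$ and of $h^\vee$ to $R$ are both $\times$-homomorphisms over $R$. **Theorem.** This closed subscheme $\mathrm{Hom}^{\mathrm{KMD}}$ exists, and $$\mathrm{Hom}^{\mathrm{KMD}}=\mathrm{Hom}^{\mathrm{full}}$$ as closed subschemes of $\mathrm{Hom}_{\mathbb{Z}}((\mathbb{Z}/p\mathbb{Z})^2,\mu_p\times\mu_p)$. -/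

import Mathlib

open TensorProduct Coalgebra

universe u

/-! ## The constant group scheme -/

/-- The coordinate ring `R^Γ` (functions `Γ → R`, with pointwise operations) of the constant group
scheme `Γ` over `Spec R`. Its Hopf algebra structure, defined below, is
`Δ(f)(x, y) = f (x + y)`, `ε(f) = f 0`, `σ(f)(x) = f (-x)`. -/
def ConstRing (R : Type*) (Γ : Type*) : Type _ := Γ → R

namespace ConstRing

section Basic

variable {R : Type*} [CommRing R] {Γ : Type*}

instance : CommRing (ConstRing R Γ) := inferInstanceAs (CommRing (Γ → R))

instance : Algebra R (ConstRing R Γ) := inferInstanceAs (Algebra R (Γ → R))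

instance [Finite Γ] : Module.Free R (ConstRing R Γ) := inferInstanceAs (Module.Free R (Γ → R))

instance [Finite Γ] : Module.Finite R (ConstRing R Γ) := inferInstanceAs (Module.Finite R (Γ → R))

/-- Evaluation of a function at a point. -/
def ev (a : Γ) : ConstRing R Γ →ₐ[R] R := Pi.evalAlgHom R (fun _ : Γ => R) a

theorem ext_ev {f g : ConstRing R Γ} (h : ∀ a, ev a f = ev a g) : f = g := funext h

/-- The function with given values. -/
def ofFun (f : Γ → R) : ConstRing R Γ := f

@[simp] theorem ev_ofFun (f : Γ → R) (a : Γ) : ev a (ofFun f) = f a := rfl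

/-- The indicator function of a point. -/
def ind [DecidableEq Γ] (a : Γ) : ConstRing R Γ := ofFun fun x => if x = a then 1 else 0

@[simp] theorem ev_ind [DecidableEq Γ] (a x : Γ) :
    ev x (ind a : ConstRing R Γ) = if x = a then 1 else 0 := rfl

theorem ind_mul [DecidableEq Γ] (a : Γ) (f : ConstRing R Γ) : ind a * f = ev a f • ind a := by
  refine ext_ev fun x => ?_
  rw [map_mul, map_smul, ev_ind, smul_eq_mul]
  split_ifs with h <;> simp [h]

theorem sum_ind [DecidableEq Γ] [Fintype Γ] : ∑ a : Γ, (ind a : ConstRing R Γ) = 1 := by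
  refine ext_ev fun x => ?_
  simp [map_sum]

theorem sum_ev_smul_ind [DecidableEq Γ] [Fintype Γ] (f : ConstRing R Γ) :
    ∑ a : Γ, ev a f • (ind a : ConstRing R Γ) = f := by
  refine ext_ev fun x => ?_
  simp [map_sum]

end Basic

section Hopf

variable {R : Type*} [CommRing R] {Γ : Type*} [AddCommGroup Γ]

/-- The translate `x ↦ f (a + x)` of a function. -/
def shift (a : Γ) : ConstRing R Γ →ₐ[R] ConstRing R Γ where
  toFun f := ofFun fun x => ev (a + x) f
  map_one' := rfl
  map_mul' _ _ := rfl
  map_zero' := rfl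
  map_add' _ _ := rfl
  commutes' _ := rfl

@[simp] theorem ev_shift (a b : Γ) (f : ConstRing R Γ) : ev b (shift a f) = ev (a + b) f := rfl

/-- The reflection `x ↦ f (-x)` of a function. -/
def reflect : ConstRing R Γ →ₐ[R] ConstRing R Γ where
  toFun f := ofFun fun x => ev (-x) f
  map_one' := rfl
  map_mul' _ _ := rfl
  map_zero' := rfl
  map_add' _ _ := rfl
  commutes' _ := rfl

@[simp] theorem ev_reflect (b : Γ) (f : ConstRing R Γ) : ev b (reflect f) = ev (-b) f := rfl

theorem shift_ind [DecidableEq Γ] (a c : Γ) :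
    shift c (ind a : ConstRing R Γ) = ind (a - c) := by
  refine ext_ev fun x => ?_
  simp [eq_sub_iff_add_eq, add_comm]

theorem shift_shift (a c : Γ) (f : ConstRing R Γ) :
    shift c (shift a f) = shift (a + c) f := by
  refine ext_ev fun x => ?_
  simp [add_assoc]

variable [Fintype Γ] [DecidableEq Γ]

/-- `Δ(f) = ∑ₐ 1ₐ ⊗ f(a + ·)`, which is the function `(x, y) ↦ f (x + y)` on `Γ × Γ`, and
`ε(f) = f 0`. -/
instance : CoalgebraStruct R (ConstRing R Γ) where
  comul := ∑ a : Γ,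
    TensorProduct.mk R (ConstRing R Γ) (ConstRing R Γ) (ind a) ∘ₗ (shift a).toLinearMap
  counit := (ev 0).toLinearMap

theorem comul_apply (f : ConstRing R Γ) :
    comul (R := R) f = ∑ a : Γ, ind a ⊗ₜ[R] shift a f := by
  simp [comul]

theorem counit_apply (f : ConstRing R Γ) : counit (R := R) f = ev 0 f := rfl

/-- The comultiplication is the function `(x, y) ↦ f (x + y)`. -/
theorem ev_ev_comul (f : ConstRing R Γ) (x y : Γ) :
    Algebra.TensorProduct.lift (ev x) (ev y) (fun _ _ => Commute.all _ _) (comul (R := R) f) =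
      ev (x + y) f := by
  simp [comul_apply, map_sum]

instance : Coalgebra R (ConstRing R Γ) where
  coassoc := by
    ext f
    simp only [LinearMap.comp_apply, LinearEquiv.coe_coe, comul_apply, map_sum,
      LinearMap.rTensor_tmul, LinearMap.lTensor_tmul, TensorProduct.sum_tmul,
      TensorProduct.tmul_sum, TensorProduct.assoc_tmul, shift_ind, shift_shift]
    rw [Finset.sum_comm]
    refine Finset.sum_congr rfl fun c _ => ?_
    refine Fintype.sum_equiv (Equiv.subRight c) _ _ fun a => ?_
    simp
  rTensor_counit_comp_comul := by
    ext f
    simp only [LinearMap.comp_apply, comul_apply, map_sum, LinearMap.rTensor_tmul, counit_apply,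
      TensorProduct.mk_apply]
    rw [Finset.sum_eq_single 0]
    · congr 1
      · simp
      · exact ext_ev fun x => by simp
    · intro b _ hb
      rw [ev_ind, if_neg hb.symm, TensorProduct.zero_tmul]
    · simp
  lTensor_counit_comp_comul := by
    ext f
    simp only [LinearMap.comp_apply, comul_apply, map_sum, LinearMap.lTensor_tmul, counit_apply,
      LinearMap.flip_apply, TensorProduct.mk_apply, ev_shift, add_zero]
    conv_rhs => rw [← sum_ev_smul_ind f, TensorProduct.sum_tmul]
    refine Finset.sum_congr rfl fun a _ => ?_
    rw [TensorProduct.smul_tmul, smul_eq_mul, mul_one]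

instance : Coalgebra.IsCocomm R (ConstRing R Γ) where
  comm_comp_comul := by
    ext f
    have h (a : Γ) : shift a f = ∑ b : Γ, ev (a + b) f • (ind b : ConstRing R Γ) :=
      (sum_ev_smul_ind (shift a f)).symm
    simp only [LinearMap.comp_apply, LinearEquiv.coe_coe, comul_apply, map_sum,
      TensorProduct.comm_tmul]
    simp only [h, TensorProduct.sum_tmul, TensorProduct.tmul_sum]
    rw [Finset.sum_comm]
    refine Finset.sum_congr rfl fun a _ => Finset.sum_congr rfl fun b _ => ?_
    rw [TensorProduct.smul_tmul, add_comm]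

instance : Bialgebra R (ConstRing R Γ) := Bialgebra.mk' R (ConstRing R Γ)
  (map_one (ev 0)) (map_mul (ev 0) _ _)
  (by simp only [comul_apply, map_one, ← TensorProduct.sum_tmul, sum_ind]; rfl)
  (by
    intro f g
    simp only [comul_apply, map_mul, Finset.sum_mul_sum, Algebra.TensorProduct.tmul_mul_tmul,
      ind_mul, ev_ind]
    refine Finset.sum_congr rfl fun a _ => ?_
    rw [Finset.sum_eq_single a]
    · simp
    · intro b _ hb; simp [hb.symm]
    · simp)

instance : HopfAlgebra R (ConstRing R Γ) where
  antipode := reflect.toLinearMap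
  mul_antipode_rTensor_comul := by
    ext f
    simp only [LinearMap.comp_apply, comul_apply, map_sum, LinearMap.rTensor_tmul,
      LinearMap.mul'_apply, AlgHom.toLinearMap_apply]
    have h (a : Γ) : reflect (ind a : ConstRing R Γ) = ind (-a) :=
      ext_ev fun x => by simp [neg_eq_iff_eq_neg]
    simp only [h, ind_mul, ev_shift, add_neg_cancel, ← Finset.smul_sum]
    rw [Fintype.sum_equiv (Equiv.neg Γ) _ (fun a => (ind a : ConstRing R Γ)) (by simp), sum_ind]
    rw [Algebra.linearMap_apply, Algebra.algebraMap_eq_smul_one, counit_apply]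
  mul_antipode_lTensor_comul := by
    ext f
    simp only [LinearMap.comp_apply, comul_apply, map_sum, LinearMap.lTensor_tmul,
      LinearMap.mul'_apply, AlgHom.toLinearMap_apply]
    have h (a : Γ) : ev a (reflect (shift a f)) = ev 0 f := by simp
    simp only [h, ind_mul, ← Finset.smul_sum, sum_ind]
    rw [Algebra.linearMap_apply, Algebra.algebraMap_eq_smul_one, counit_apply]

end Hopf

end ConstRing

namespace FullLevel

/-! ## `×`-homomorphisms and Cartier duals -/

/-- Let `Z = Spec B` and `Z' = Spec B'` be finite (locally) free over `Spec R`, and let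
`Z' → Z` be given by `φ : B → B'`. It is a `×`-homomorphism in the sense of Katz and Mazur if for
every `R`-algebra `R'` and every function `f` on `Z ×_R R'`, the elements `f` and `φ^*(f)` have the
same characteristic polynomial `det(T - f) = det(T - φ^* f)` in `R'[T]`. -/
def IsTimesHom {R : Type u} [CommRing R] {B B' : Type*}
    [CommRing B] [Algebra R B] [Module.Free R B] [Module.Finite R B]
    [CommRing B'] [Algebra R B'] [Module.Free R B'] [Module.Finite R B']
    (φ : B →ₐ[R] B') : Prop :=
  ∀ (R' : Type u) [CommRing R'] [Algebra R R'] (f : R' ⊗[R] B),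
    (Algebra.lmul R' (R' ⊗[R] B) f).charpoly =
      (Algebra.lmul R' (R' ⊗[R] B')
        (Algebra.TensorProduct.map (AlgHom.id R' R') φ f)).charpoly

/-- The coordinate ring of the Cartier dual of `G = Spec B`: the `R`-linear dual of `B`, whose
multiplication is dual to the comultiplication of `B` (the convolution product) and whose unit is
the counit of `B`. -/
abbrev CartierDual (R : Type*) [CommRing R] (B : Type*) [CommRing B] [Bialgebra R B] : Type _ :=
  WithConv (B →ₗ[R] R)

instance (R : Type*) [CommRing R] (B : Type*) [CommRing B] [Bialgebra R B]
    [Module.Free R B] [Module.Finite R B] : Module.Free R (CartierDual R B) :=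
  Module.Free.of_equiv (WithConv.linearEquiv R (B →ₗ[R] R)).symm

instance (R : Type*) [CommRing R] (B : Type*) [CommRing B] [Bialgebra R B]
    [Module.Free R B] [Module.Finite R B] : Module.Finite R (CartierDual R B) :=
  Module.Finite.equiv (WithConv.linearEquiv R (B →ₗ[R] R)).symm

/-- The Cartier dual `h^∨ : H^∨ → G^∨` of the homomorphism `h : G = Spec B' → H = Spec B` given by
`h : B → B'`, on coordinate rings: the transpose `(B')^* → B^*`. -/
noncomputable def cartierDualHom {R : Type*} [CommRing R] {B B' : Type*} [CommRing B] [Bialgebra R B]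
    [CommRing B'] [Bialgebra R B'] (h : B →ₐc[R] B') :
    CartierDual R B' →ₐ[R] CartierDual R B :=
  AlgHom.ofLinearMap
    { toFun := fun f => WithConv.toConv (f.ofConv ∘ₗ (h : B →ₗ[R] B'))
      map_add' := fun f g => by ext; simp
      map_smul' := fun c f => by ext; simp }
    (by ext x; simp)
    (by
      intro f g
      exact congrArg WithConv.toConv
        (LinearMap.convMul_comp_coalgHom_distrib f g (h : B →ₗc[R] B')))

/-! ## Homomorphisms from `(ℤ/p)²` to `μ_p × μ_p` -/

/-- The group `(ℤ/p)²`. -/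
abbrev Gam (p : ℕ) : Type := ZMod p × ZMod p

/-- The coordinate ring `R[x, y]/(x^p - 1, y^p - 1)` of `μ_p × μ_p` over `R`, written as the group
algebra of `(ℤ/p)²`: the monomial `x^k y^l` is `single (k, l) 1`, and it is group-like. -/
abbrev MuRing (R : Type*) [CommRing R] (p : ℕ) : Type _ := AddMonoidAlgebra R (Gam p)

/-- The functor of points of `Hom_ℤ((ℤ/p)², μ_p × μ_p)`: its value at `R` is the set of
homomorphisms of group schemes `(ℤ/p)² → μ_p × μ_p` over `R`, given on coordinate rings. -/
abbrev HomPt (p : ℕ) [NeZero p] (R : Type*) [CommRing R] : Type _ :=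
  MuRing R p →ₐc[R] ConstRing R (Gam p)

theorem muRing_algHom_ext {p : ℕ} {R : Type*} [CommRing R] {B : Type*} [Semiring B] [Algebra R B]
    {f g : MuRing R p →ₐ[R] B}
    (h : ∀ a, f (AddMonoidAlgebra.single a 1) = g (AddMonoidAlgebra.single a 1)) : f = g :=
  AddMonoidAlgebra.algHom_ext h (Subsingleton.elim _ _)

section Points

variable {p : ℕ} [NeZero p] {R : Type*} [CommRing R]

/-- The value of the monomial `x^k y^l`, where `g = (k, l)`, at the image of `a ∈ (ℤ/p)²` under
a homomorphism. -/
noncomputable def HomPt.val (h : HomPt p R) (g a : Gam p) : R := ConstRing.ev a (h (AddMonoidAlgebra.single g 1))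

theorem HomPt.ext_val {h h' : HomPt p R} (H : ∀ g a, h.val g a = h'.val g a) : h = h' := by
  have : (h : MuRing R p →ₐ[R] ConstRing R (Gam p)) = (h' : MuRing R p →ₐ[R] _) :=
    muRing_algHom_ext fun g => ConstRing.ext_ev fun a => H g a
  exact DFunLike.ext _ _ fun x => DFunLike.congr_fun this x

theorem HomPt.val_zero_left (h : HomPt p R) (a : Gam p) : h.val 0 a = 1 := by
  have : (AddMonoidAlgebra.single 0 1 : MuRing R p) = 1 := rfl
  rw [HomPt.val, this, map_one, map_one]

theorem HomPt.val_add_left (h : HomPt p R) (g g' a : Gam p) :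
    h.val (g + g') a = h.val g a * h.val g' a := by
  have : (AddMonoidAlgebra.single (g + g') 1 : MuRing R p) =
      AddMonoidAlgebra.single g 1 * AddMonoidAlgebra.single g' 1 := by
    rw [AddMonoidAlgebra.single_mul_single, one_mul]
  simp only [HomPt.val, this, map_mul]

theorem HomPt.val_zero_right (h : HomPt p R) (g : Gam p) : h.val g 0 = 1 := by
  have := CoalgHomClass.counit_comp_apply (R := R) h (AddMonoidAlgebra.single g 1 : MuRing R p)
  rw [ConstRing.counit_apply] at this
  rw [HomPt.val, this]
  simp

theorem HomPt.val_add_right (h : HomPt p R) (g a a' : Gam p) :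
    h.val g (a + a') = h.val g a * h.val g a' := by
  have := CoalgHomClass.map_comp_comul_apply (R := R) h
    (AddMonoidAlgebra.single g 1 : MuRing R p)
  rw [HomPt.val, ← ConstRing.ev_ev_comul, ← this]
  simp [HomPt.val]

/-- The homomorphism attached to a bimultiplicative pairing `χ`, where `χ g a` is the value of
`x^k y^l`, `g = (k, l)`, at the image of `a`. -/
noncomputable def HomPt.ofVal (χ : Gam p → Gam p → R) (h0 : ∀ a, χ 0 a = 1)
    (hadd : ∀ g g' a, χ (g + g') a = χ g a * χ g' a) (h0' : ∀ g, χ g 0 = 1)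
    (hadd' : ∀ g a a', χ g (a + a') = χ g a * χ g a') : HomPt p R :=
  BialgHom.ofAlgHom
    (AddMonoidAlgebra.lift R (ConstRing R (Gam p)) (Gam p)
      { toFun := fun g => ConstRing.ofFun (χ g.toAdd)
        map_one' := ConstRing.ext_ev h0
        map_mul' := fun g g' => ConstRing.ext_ev fun a => hadd g.toAdd g'.toAdd a })
    (by
      refine muRing_algHom_ext fun g => ?_
      simp [ConstRing.counit_apply, h0'])
    (by
      refine muRing_algHom_ext fun g => ?_
      have h (a : Gam p) : ConstRing.shift a (ConstRing.ofFun (χ g)) =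
          χ g a • ConstRing.ofFun (χ g) := ConstRing.ext_ev fun b => by simp [hadd']
      have h2 := ConstRing.sum_ev_smul_ind (ConstRing.ofFun (χ g))
      simp only [ConstRing.ev_ofFun] at h2
      simp only [AlgHom.comp_apply, Bialgebra.comulAlgHom_apply, AddMonoidAlgebra.comul_single,
        CommSemiring.comul_apply, TensorProduct.map_tmul, AddMonoidAlgebra.lsingle_apply,
        Algebra.TensorProduct.map_tmul, AddMonoidAlgebra.lift_single, one_smul, MonoidHom.coe_mk,
        OneHom.coe_mk, toAdd_ofAdd, ConstRing.comul_apply, h]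
      simp only [← TensorProduct.smul_tmul, ← TensorProduct.sum_tmul, h2])

@[simp] theorem HomPt.val_ofVal (χ : Gam p → Gam p → R) (h0 hadd h0' hadd') (g a : Gam p) :
    (HomPt.ofVal χ h0 hadd h0' hadd').val g a = χ g a := by
  simp [HomPt.val, HomPt.ofVal]

/-- Base change of a homomorphism along `φ : R → R'`; with the identifications
`R' ⊗ R[x, y]/(x^p - 1, y^p - 1) = R'[x, y]/(x^p - 1, y^p - 1)` and `R' ⊗ R^Γ = R'^Γ`, it is
obtained by applying `φ` to the values. -/
noncomputable def HomPt.map {R' : Type*} [CommRing R'] (φ : R →+* R') (h : HomPt p R) : HomPt p R' :=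
  HomPt.ofVal (fun g a => φ (h.val g a)) (fun a => by rw [h.val_zero_left, map_one])
    (fun g g' a => by rw [h.val_add_left, map_mul]) (fun g => by rw [h.val_zero_right, map_one])
    (fun g a a' => by rw [h.val_add_right, map_mul])

theorem pow_val_add {s : R} (hs : s ^ p = 1) (k l : ZMod p) :
    s ^ (k + l).val = s ^ k.val * s ^ l.val := by
  rw [ZMod.val_add, ← pow_add, ← pow_eq_pow_mod _ hs]

/-- The homomorphism with matrix `m = (S T; U V)`, whose entries are `p`-th roots of unity: it sends
`(i, j) ∈ (ℤ/p)²` to `(S^i U^j, T^i V^j)`, so `(1, 0) ↦ (S, T)` and `(0, 1) ↦ (U, V)`. -/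
noncomputable def HomPt.ofMatrix (m : Fin 2 → Fin 2 → R) (hm : ∀ i j, m i j ^ p = 1) : HomPt p R :=
  HomPt.ofVal
    (fun g a => m 0 0 ^ (a.1 * g.1).val * m 1 0 ^ (a.2 * g.1).val *
      (m 0 1 ^ (a.1 * g.2).val * m 1 1 ^ (a.2 * g.2).val))
    (fun a => by simp)
    (fun g g' a => by
      simp only [Prod.fst_add, Prod.snd_add, mul_add, pow_val_add (hm _ _)]; ring)
    (fun g => by simp)
    (fun g a a' => by
      simp only [Prod.fst_add, Prod.snd_add, add_mul, pow_val_add (hm _ _)]; ring)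

end Points

/-! ## The scheme of homomorphisms and its universal homomorphism -/

/-- The coordinate ring `𝒜 = ℤ[S, T, U, V]/(S^p - 1, T^p - 1, U^p - 1, V^p - 1)` of
`Hom_ℤ((ℤ/p)², μ_p × μ_p)`. -/
def CoordRing (p : ℕ) : Type :=
  MvPolynomial (Fin 2 × Fin 2) ℤ ⧸
    Ideal.span (Set.range fun i : Fin 2 × Fin 2 => (MvPolynomial.X i ^ p - 1 : MvPolynomial _ ℤ))

noncomputable instance (p : ℕ) : CommRing (CoordRing p) :=
  inferInstanceAs (CommRing (MvPolynomial (Fin 2 × Fin 2) ℤ ⧸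
    Ideal.span (Set.range fun i : Fin 2 × Fin 2 => (MvPolynomial.X i ^ p - 1 : MvPolynomial _ ℤ))))

/-- The quotient map `ℤ[S, T, U, V] → 𝒜`. -/
noncomputable def CoordRing.mk (p : ℕ) : MvPolynomial (Fin 2 × Fin 2) ℤ →+* CoordRing p :=
  Ideal.Quotient.mk _

/-- The entries of the universal matrix `(S T; U V)`. -/
noncomputable def entry (p : ℕ) (i j : Fin 2) : CoordRing p := CoordRing.mk p (MvPolynomial.X (i, j))

theorem entry_pow (p : ℕ) (i j : Fin 2) : entry p i j ^ p = 1 := by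
  rw [entry, ← map_pow, ← map_one (CoordRing.mk p)]
  refine Ideal.Quotient.eq.2 ?_
  exact Ideal.subset_span ⟨(i, j), rfl⟩

/-- The universal homomorphism `(ℤ/p)² → μ_p × μ_p` over `𝒜`. -/
noncomputable def univHom (p : ℕ) [NeZero p] : HomPt p (CoordRing p) :=
  HomPt.ofMatrix (entry p) (entry_pow p)

theorem entry_hom_ext {p : ℕ} {R : Type*} [CommRing R] {φ ψ : CoordRing p →+* R}
    (h : ∀ i j, φ (entry p i j) = ψ (entry p i j)) : φ = ψ :=
  Ideal.Quotient.ringHom_ext (MvPolynomial.ringHom_ext (by simp) fun i => h i.1 i.2)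

/-- The standard basis of `(ℤ/p)²`. -/
def stdVec (p : ℕ) (i : Fin 2) : Gam p := if i = 0 then (1, 0) else (0, 1)

theorem HomPt.val_nsmul {p : ℕ} [NeZero p] {R : Type*} [CommRing R] (h : HomPt p R) (g a : Gam p)
    (k l : ℕ) : h.val (k • g) (l • a) = h.val g a ^ (l * k) := by
  have h1 (k : ℕ) (a : Gam p) : h.val (k • g) a = h.val g a ^ k := by
    induction k with
    | zero => simp [h.val_zero_left]
    | succ k ih => rw [add_smul, one_smul, h.val_add_left, ih, pow_succ]
  have h2 (l : ℕ) : h.val g (l • a) = h.val g a ^ l := by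
    induction l with
    | zero => simp [h.val_zero_right]
    | succ l ih => rw [add_smul, one_smul, h.val_add_right, ih, pow_succ]
  rw [h1, h2, pow_mul]

theorem gam_eq {p : ℕ} [NeZero p] (g : Gam p) :
    g = g.1.val • stdVec p 0 + g.2.val • stdVec p 1 := by
  ext <;> simp [stdVec]

theorem HomPt.val_std_pow {p : ℕ} [NeZero p] {R : Type*} [CommRing R] (h : HomPt p R)
    (i j : Fin 2) : h.val (stdVec p j) (stdVec p i) ^ p = 1 := by
  have := h.val_nsmul (stdVec p j) (stdVec p i) p 1
  rw [one_mul, one_smul] at this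
  rw [← this, ← h.val_zero_left (stdVec p i)]
  congr 1
  ext <;> simp

theorem HomPt.val_eq {p : ℕ} [NeZero p] {R : Type*} [CommRing R] (h : HomPt p R) (g a : Gam p) :
    h.val g a =
      h.val (stdVec p 0) (stdVec p 0) ^ (a.1 * g.1).val *
        h.val (stdVec p 0) (stdVec p 1) ^ (a.2 * g.1).val *
      (h.val (stdVec p 1) (stdVec p 0) ^ (a.1 * g.2).val *
        h.val (stdVec p 1) (stdVec p 1) ^ (a.2 * g.2).val) := by
  conv_lhs => rw [gam_eq g, gam_eq a]
  simp only [h.val_add_left, h.val_add_right, h.val_nsmul, ZMod.val_mul,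
    ← pow_eq_pow_mod _ (h.val_std_pow _ _)]

theorem univHom_val_std (p : ℕ) [NeZero p] (i j : Fin 2) :
    (univHom p).val (stdVec p j) (stdVec p i) = entry p i j := by
  have h1 (s : CoordRing p) (hs : s ^ p = 1) : s ^ (1 : ZMod p).val = s := by
    rw [← Nat.cast_one, ZMod.val_natCast, ← pow_eq_pow_mod _ hs, pow_one]
  fin_cases i <;> fin_cases j <;>
    simp [univHom, HomPt.ofMatrix, stdVec, h1 _ (entry_pow p _ _)]

/-- `Spec 𝒜`, with the universal homomorphism, represents the functor of homomorphisms
`(ℤ/p)² → μ_p × μ_p`. -/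
theorem univHom_universal (p : ℕ) [NeZero p] (R : Type*) [CommRing R] (h : HomPt p R) :
    ∃! φ : CoordRing p →+* R, (univHom p).map φ = h := by
  let φ : CoordRing p →+* R := Ideal.Quotient.lift _
    (MvPolynomial.eval₂Hom (Int.castRingHom R) fun i => h.val (stdVec p i.2) (stdVec p i.1))
    (by
      have : Ideal.span (Set.range fun i : Fin 2 × Fin 2 =>
          (MvPolynomial.X i ^ p - 1 : MvPolynomial _ ℤ)) ≤ RingHom.ker
          (MvPolynomial.eval₂Hom (Int.castRingHom R)
            fun i : Fin 2 × Fin 2 => h.val (stdVec p i.2) (stdVec p i.1)) := by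
        rw [Ideal.span_le]
        rintro _ ⟨i, rfl⟩
        simp [RingHom.mem_ker, h.val_std_pow]
      exact fun a ha => this ha)
  have hφ (i j : Fin 2) : φ (entry p i j) = h.val (stdVec p j) (stdVec p i) := by
    change MvPolynomial.eval₂Hom _ _ (MvPolynomial.X (i, j)) = _
    simp
  have hv (ψ : CoordRing p →+* R) (g a : Gam p) :
      ((univHom p).map ψ).val g a = ψ ((univHom p).val g a) := by
    simp [HomPt.map]
  refine ⟨φ, HomPt.ext_val fun g a => ?_, fun ψ hψ => entry_hom_ext fun i j => ?_⟩
  · rw [hv, (univHom p).val_eq, h.val_eq]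
    simp only [map_mul, map_pow, univHom_val_std, hφ]
  · rw [hφ, ← hψ, hv, univHom_val_std]

/-- The scheme `Hom_ℤ((ℤ/p)², μ_p × μ_p) = Spec 𝒜`. -/
noncomputable abbrev HomScheme (p : ℕ) : AlgebraicGeometry.Scheme :=
  AlgebraicGeometry.Spec (CommRingCat.of (CoordRing p))

/-- The closed subscheme `Spec (𝒜/I)` of `Spec 𝒜`, given by its quasi-coherent ideal sheaf. -/
noncomputable def closedSubscheme {p : ℕ} (I : Ideal (CoordRing p)) :
    (HomScheme p).IdealSheafData :=
  AlgebraicGeometry.Scheme.IdealSheafData.ofIdealTop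
    (I.map (AlgebraicGeometry.Scheme.ΓSpecIso (CommRingCat.of (CoordRing p))).inv.hom)

/-! ## The full homomorphisms -/

/-- `Φ_p(x) = 1 + x + ⋯ + x^{p-1}`. -/
def Phi {R : Type*} [CommRing R] (p : ℕ) (x : R) : R := ∑ i ∈ Finset.range p, x ^ i

/-- The equation `Φ_p(x) Φ_p(y)` (to be zero) of primitivity of a point `(x, y)` of
`μ_p × μ_p`. -/
def primEq {R : Type*} [CommRing R] (p : ℕ) (x y : R) : R := Phi p x * Phi p y

/-- The ideal `ℐ` of `𝒜` generated by the equations which say that every nontrivial combination of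
the two rows `(S, T)`, `(U, V)`, and every nontrivial combination of the two columns `(S, U)`,
`(T, V)`, of the universal homomorphism is primitive. -/
noncomputable def fullIdeal (p : ℕ) : Ideal (CoordRing p) :=
  Ideal.span
    ({f | ∃ ab : ZMod p × ZMod p, ab ≠ 0 ∧
        f = primEq p (entry p 0 0 ^ ab.1.val * entry p 1 0 ^ ab.2.val)
          (entry p 0 1 ^ ab.1.val * entry p 1 1 ^ ab.2.val)} ∪
     {f | ∃ ab : ZMod p × ZMod p, ab ≠ 0 ∧
        f = primEq p (entry p 0 0 ^ ab.1.val * entry p 0 1 ^ ab.2.val)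
          (entry p 1 0 ^ ab.1.val * entry p 1 1 ^ ab.2.val)})

/-- The closed subscheme `Hom^full` of full homomorphisms. -/
noncomputable def HomFull (p : ℕ) : (HomScheme p).IdealSheafData := closedSubscheme (fullIdeal p)

/-! ## The Katz-Mazur-Drinfeld homomorphisms -/

/-- A homomorphism `h : (ℤ/p)² → μ_p × μ_p` over `R` such that both `h` and its Cartier dual
`h^∨` are `×`-homomorphisms. -/
def IsKMD {p : ℕ} [NeZero p] {R : Type u} [CommRing R] (h : HomPt p R) : Prop :=
  IsTimesHom (h : MuRing R p →ₐ[R] ConstRing R (Gam p)) ∧ IsTimesHom (cartierDualHom h)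

/-- The ideal `ℐ^KMD` of `𝒜`: the smallest ideal `J` such that the restriction of the universal
homomorphism to `Spec (𝒜/J)` satisfies `IsKMD`. -/
noncomputable def kmdIdeal (p : ℕ) [NeZero p] : Ideal (CoordRing p) :=
  sInf {J | IsKMD ((univHom p).map (Ideal.Quotient.mk J))}

/-- The closed subscheme `Hom^KMD`. -/
noncomputable def HomKMD (p : ℕ) [NeZero p] : (HomScheme p).IdealSheafData :=
  closedSubscheme (kmdIdeal p)

end FullLevel

/-! ## Affine planes of singular direction in the space of `2 × 2` matrices -/

namespace FullLevel

/-! Write `χ g a` for the value of the monomial `g` at the image of `a`. Sending `g` to its row of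
values maps a group algebra, with basis the monomials, to a ring of functions, with basis the
indicators. Cartier duality exchanges these two kinds of ring and transposes `χ`. Comparing traces
on a basis element shows that a `×`-homomorphism has `∑ a, χ g a = 0` for `g ≠ 0`; the dual gives `∑
g, χ g a = 0` for `a ≠ 0`. These sums factor as the products of `Φ_p` generating `fullIdeal`, so
what remains is that the orthogonality relations imply the `×`-condition (`isKMD_iff`).

That converse is the determinant identity `IsFullPairing.det_eq_prod`. If `p` is a nonzerodivisor,
it follows from orthogonality: the character table intertwines multiplication in the group algebra
with a diagonal matrix, and its determinant divides a power of `p`. The general case specializes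
from the universal ring `OrthRing p`, once that ring is known to have no `p`-torsion
(`natCast_mem_nonZeroDivisors_orthRing`).

`OrthRing p` is the group ring of the `2 × 2` matrices over `ℤ/p` modulo an ideal which, as a
lattice of integer functions, is spanned by the indicators of affine planes on which some
combination of rows, or of columns, is constant. Absence of `p`-torsion means that this lattice is
saturated at `p` (`mem_planeSpan_of_smul_mem`). Its rank is at most `N = (p + 1)(p² - 1) + 1`, since
`p` times a column plane is a combination of row planes (`finrank_planeSpan_le`). Its reduction
modulo `p` has dimension at least `N`, by an explicit independent family of polynomials
(`le_finrank_modPlaneSpan`). Hence a `ℤ`-basis of the lattice stays independent modulo `p`. -/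

/-- The linear form `(v, w) ↦ v + β w` attached to the point `β` of the projective line, where
`none` is the point at infinity and gives `(v, w) ↦ w`. -/
def comb {F M : Type*} [SMul F M] [Add M] (a : Option F) (v w : M) : M :=
  a.elim w fun β => v + β • w

/-- The space of `2 × 2` matrices over `ℤ/p`, as pairs of rows. -/
abbrev Mat (p : ℕ) : Type := Gam p × Gam p

/-- The transpose of a matrix. -/
def Mat.tr {p : ℕ} (X : Mat p) : Mat p := ((X.1.1, X.2.1), (X.1.2, X.2.2))

theorem Mat.tr_tr {p : ℕ} (X : Mat p) : X.tr.tr = X := rfl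

/-- The indicator function of the affine plane of matrices with a given combination of rows. -/
def rowInd {p : ℕ} (a : Option (ZMod p)) (t : Gam p) (X : Mat p) : ℤ :=
  if comb a X.1 X.2 = t then 1 else 0

/-- The indicator function of the affine plane of matrices with a given combination of columns. -/
def colInd {p : ℕ} (a : Option (ZMod p)) (t : Gam p) (X : Mat p) : ℤ := rowInd a t X.tr

/-- The span of the indicator functions of all affine planes in a singular direction. -/
def planeSpan (p : ℕ) : Submodule ℤ (Mat p → ℤ) :=
  Submodule.span ℤ ({f | ∃ a t, f = rowInd a t} ∪ {f | ∃ a t, f = colInd a t})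

/-- Both sides evaluate the same bilinear expression: contracting rows with `a` commutes with
contracting columns with `b`. -/
theorem comb_comb {p : ℕ} (a b : Option (ZMod p)) (X : Mat p) :
    comb b (comb a X.1 X.2).1 (comb a X.1 X.2).2 =
      comb a (comb b X.tr.1 X.tr.2).1 (comb b X.tr.1 X.tr.2).2 := by
  cases a <;> cases b <;> simp [comb, Mat.tr]
  ring

/-- The span of the indicator functions of planes of row type. -/
def rowSpan (p : ℕ) : Submodule ℤ (Mat p → ℤ) :=
  Submodule.span ℤ (Set.range fun i : Option (Option (ZMod p) × {t : Gam p // t ≠ 0}) =>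
    i.elim 1 fun j => rowInd j.1 j.2)

theorem one_mem_rowSpan {p : ℕ} : (1 : Mat p → ℤ) ∈ rowSpan p :=
  Submodule.subset_span ⟨none, rfl⟩

section

variable {p : ℕ} [Fact p.Prime]

/-- A nonzero vector `w - u` is killed by exactly one of the `p + 1` points of the projective line,
the zero vector by all of them. -/
theorem sum_comb_eq (w u : Gam p) :
    ∑ a : Option (ZMod p), (if comb a w.1 w.2 = comb a u.1 u.2 then (1 : ℤ) else 0) =
      1 + p * if w = u then 1 else 0 := by
  rw [Fintype.sum_option]
  simp only [comb, Option.elim, smul_eq_mul]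
  by_cases h2 : w.2 = u.2
  · by_cases h1 : w.1 = u.1
    · have : w = u := Prod.ext h1 h2
      simp [this, ZMod.card]
    · have : w ≠ u := fun h => h1 (by rw [h])
      simp [h2, h1, this]
  · have : w ≠ u := fun h => h2 (by rw [h])
    have h3 (β : ZMod p) : w.1 + β * w.2 = u.1 + β * u.2 ↔ β = (u.1 - w.1) / (w.2 - u.2) := by
      rw [eq_div_iff (sub_ne_zero.2 h2)]
      constructor <;> intro h <;> linear_combination h
    simp [h2, this, h3]

theorem rowInd_mem_rowSpan (a : Option (ZMod p)) (t : Gam p) : rowInd a t ∈ rowSpan p := by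
  have h (t : Gam p) (ht : t ≠ 0) : rowInd a t ∈ rowSpan p :=
    Submodule.subset_span ⟨some (a, ⟨t, ht⟩), rfl⟩
  by_cases ht : t = 0
  -- The parallel planes in direction `a` partition the space, so the omitted plane is `1` minus the
  -- others.
  · have : rowInd a t = 1 - ∑ t ∈ Finset.univ.erase (0 : Gam p), rowInd a t := by
      rw [eq_sub_iff_add_eq, ht, Finset.add_sum_erase _ _ (Finset.mem_univ _)]
      ext X
      simp [Finset.sum_apply, rowInd]
    rw [this]
    exact sub_mem one_mem_rowSpan (sum_mem fun t ht => h t (Finset.ne_of_mem_erase ht))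
  · exact h t ht

/-- Apply `sum_comb_eq` to the `b`-combination `w` of the columns of `X`. By `comb_comb`, its
`a`-combination depends only on the `a`-combination of the rows, so each term is a sum of row
planes. -/
theorem p_smul_colInd_mem_rowSpan (b : Option (ZMod p)) (u : Gam p) :
    (p : ℤ) • colInd b u ∈ rowSpan p := by
  have : (p : ℤ) • colInd b u = (∑ a : Option (ZMod p),
      ∑ t ∈ Finset.univ.filter (fun t : Gam p => comb b t.1 t.2 = comb a u.1 u.2),
        rowInd a t) - 1 := by
    rw [eq_sub_iff_add_eq]
    ext X
    simp only [Pi.add_apply, Pi.smul_apply, Finset.sum_apply, rowInd, colInd, smul_eq_mul,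
      Pi.one_apply]
    rw [add_comm, ← sum_comb_eq]
    refine Finset.sum_congr rfl fun a _ => ?_
    rw [Finset.sum_ite_eq]
    simp only [Finset.mem_filter, Finset.mem_univ, true_and, comb_comb a b X]
  rw [this]
  exact sub_mem (sum_mem fun a _ => sum_mem fun t _ => rowInd_mem_rowSpan a t) one_mem_rowSpan

theorem finrank_rowSpan_le : Module.finrank ℤ (rowSpan p) ≤ (p + 1) * (p ^ 2 - 1) + 1 := by
  refine (finrank_range_le_card _).trans ?_
  rw [Fintype.card_option, Fintype.card_prod, Fintype.card_option, ZMod.card,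
    Fintype.card_subtype_compl, Fintype.card_prod, ZMod.card, Fintype.card_subtype_eq, sq]

theorem finrank_planeSpan_le : Module.finrank ℤ (planeSpan p) ≤ (p + 1) * (p ^ 2 - 1) + 1 := by
  have hp : (p : ℤ) ≠ 0 := by exact_mod_cast (Fact.out : p.Prime).ne_zero
  -- Multiplication by `p` embeds `planeSpan` into `rowSpan`, so the two ranks compare.
  have h : planeSpan p ≤ (rowSpan p).comap (LinearMap.lsmul ℤ (Mat p → ℤ) (p : ℤ)) := by
    refine Submodule.span_le.2 ?_
    rintro _ (⟨a, t, rfl⟩ | ⟨a, t, rfl⟩)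
    · exact Submodule.smul_mem _ _ (rowInd_mem_rowSpan a t)
    · exact p_smul_colInd_mem_rowSpan a t
  refine le_trans ?_ finrank_rowSpan_le
  refine LinearMap.finrank_le_finrank_of_injective
    (f := (LinearMap.lsmul ℤ (Mat p → ℤ) (p : ℤ)).restrict h) fun x y hxy => ?_
  have := congrArg Subtype.val hxy
  simp only [LinearMap.coe_restrict_apply, LinearMap.lsmul_apply] at this
  exact Subtype.ext (smul_right_injective _ hp this)

end

end FullLevel

/-! ## Monomial coefficients of functions on matrices modulo `p` -/

namespace FullLevel

section

variable {p : ℕ} [Fact p.Prime]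

/-- The sum of `f` against `coeffWeight a` is the coefficient of `x ^ a` in the polynomial of
degree less than `p` representing `f`. -/
def coeffWeight (a : ℕ) (x : ZMod p) : ZMod p :=
  if a = 0 then if x = 0 then 1 else 0 else -x ^ (p - 1 - a)

/-- The condition `0 < n` is needed because `0 ^ 0 = 1`, so that `n = 0` gives `p = 0`. -/
theorem sum_pow_eq (n : ℕ) :
    ∑ x : ZMod p, x ^ n = if 0 < n ∧ p - 1 ∣ n then -1 else 0 := by
  rcases Nat.eq_zero_or_pos n with rfl | hn
  · simp [ZMod.card]
  · have h1 := FiniteField.sum_pow_units (ZMod p) n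
    rw [ZMod.card] at h1
    simp only [hn, true_and]
    rw [← h1, Fintype.sum_eq_add_sum_subtype_ne _ (0 : ZMod p), zero_pow hn.ne', zero_add,
      ← unitsEquivNeZero.sum_comp]
    rfl

/-- The weight `-x ^ (p - 1 - a)` isolates `x ^ a` by `sum_pow_eq`. For `a = 0` it would detect both
`b = 0` and `b = p - 1`, whence the use of evaluation at `0` there. -/
theorem sum_coeffWeight_mul_pow {a b : ℕ} (ha : a < p) (hb : b < p) :
    ∑ x : ZMod p, coeffWeight a x * x ^ b = if a = b then 1 else 0 := by
  have hp := (Fact.out : p.Prime).two_le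
  unfold coeffWeight
  split_ifs with h0 h1 h1
  · subst h1; subst h0; simp
  · subst h0
    simp [Ne.symm h1]
  · subst h1
    have : p - 1 - a + a = p - 1 := by omega
    simp only [neg_mul, ← pow_add, this, Finset.sum_neg_distrib, sum_pow_eq]
    rw [if_pos ⟨by omega, dvd_rfl⟩, neg_neg]
  · simp only [neg_mul, ← pow_add, Finset.sum_neg_distrib, sum_pow_eq]
    rw [if_neg, neg_zero]
    rintro ⟨h2, k, hk⟩
    -- As `0 < a` and `b ≤ p - 1`, the exponent `p - 1 - a + b` is below `2(p - 1)`.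
    have : k = 1 := by
      have h3 : k < 2 := by
        by_contra! h
        have := Nat.mul_le_mul_left (p - 1) h
        omega
      interval_cases k <;> simp_all
    subst this
    omega

theorem sum_coeffWeight_mul_add_pow {a c i : ℕ} (ha : a < p) (hc : c < p) (hi : i < p)
    (β : ZMod p) :
    ∑ x : ZMod p, ∑ z : ZMod p, coeffWeight a x * coeffWeight c z * (x + β * z) ^ i =
      if a + c = i then (i.choose c : ZMod p) * β ^ c else 0 := by
  have h1 (x z : ZMod p) : coeffWeight a x * coeffWeight c z * (x + β * z) ^ i =
      ∑ m ∈ Finset.range (i + 1), (i.choose m * β ^ (i - m)) *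
        ((coeffWeight a x * x ^ m) * (coeffWeight c z * z ^ (i - m))) := by
    rw [add_pow, Finset.mul_sum]
    refine Finset.sum_congr rfl fun m _ => ?_
    rw [mul_pow]; ring
  simp only [h1]
  simp_rw [Finset.sum_comm (s := Finset.univ) (t := Finset.range (i + 1)), ← Finset.mul_sum,
    ← Finset.sum_mul]
  have h2 (m : ℕ) (hm : m ∈ Finset.range (i + 1)) :
      (i.choose m * β ^ (i - m)) *
        ((∑ x : ZMod p, coeffWeight a x * x ^ m) * ∑ z : ZMod p, coeffWeight c z * z ^ (i - m)) =
      if m = a then (if a + c = i then (i.choose c : ZMod p) * β ^ c else 0) else 0 := by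
    rw [Finset.mem_range] at hm
    rw [sum_coeffWeight_mul_pow ha (by omega), sum_coeffWeight_mul_pow hc (by omega)]
    by_cases h : m = a
    · subst h
      by_cases h' : m + c = i
      · have h3 : c = i - m := by omega
        rw [if_pos rfl, if_pos h3, if_pos rfl, if_pos h', h3, Nat.choose_symm (by omega)]
        ring
      · rw [if_neg (by omega : ¬ c = i - m), if_neg h']; simp
    · simp [h, Ne.symm h]
  rw [Finset.sum_congr rfl h2, Finset.sum_ite_eq']
  split_ifs <;> simp_all
  omega

/-- The coefficient of the monomial with exponents `(a, b; c, e)` of a function on matrices. -/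
noncomputable def matCoeff (a b c e : ℕ) : (Mat p → ZMod p) →ₗ[ZMod p] ZMod p :=
  Fintype.linearCombination (ZMod p) fun X : Mat p =>
    coeffWeight a X.1.1 * coeffWeight b X.1.2 * (coeffWeight c X.2.1 * coeffWeight e X.2.2)

theorem matCoeff_apply (a b c e : ℕ) (f : Mat p → ZMod p) :
    matCoeff a b c e f = ∑ X : Mat p, f X *
      (coeffWeight a X.1.1 * coeffWeight b X.1.2 * (coeffWeight c X.2.1 * coeffWeight e X.2.2)) := by
  simp [matCoeff, Fintype.linearCombination_apply]

theorem matCoeff_comp_tr (a b c e : ℕ) (f : Mat p → ZMod p) :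
    matCoeff a b c e (f ∘ Mat.tr) = matCoeff a c b e f := by
  simp only [matCoeff_apply]
  refine Fintype.sum_equiv ⟨Mat.tr, Mat.tr, Mat.tr_tr, Mat.tr_tr⟩ _ _ fun X => ?_
  simp only [Function.comp_apply, Equiv.coe_fn_mk, Mat.tr]
  ring

theorem matCoeff_mul (a b c e : ℕ) (f g : ZMod p → ZMod p → ZMod p) :
    matCoeff a b c e (fun X => f X.1.1 X.2.1 * g X.1.2 X.2.2) =
      (∑ x, ∑ z, coeffWeight a x * coeffWeight c z * f x z) *
        ∑ y, ∑ w, coeffWeight b y * coeffWeight e w * g y w := by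
  simp only [matCoeff_apply, Fintype.sum_prod_type]
  rw [Finset.sum_mul_sum]
  refine Finset.sum_congr rfl fun x _ => Finset.sum_congr rfl fun y _ => ?_
  rw [Finset.sum_mul_sum]
  refine Finset.sum_congr rfl fun z _ => Finset.sum_congr rfl fun w _ => ?_
  ring

/-- The monomial of bidegree `(i, j)` in a combination of the rows. -/
def rowMonomial (a : Option (ZMod p)) (i j : ℕ) (X : Mat p) : ZMod p :=
  (comb a X.1 X.2).1 ^ i * (comb a X.1 X.2).2 ^ j

theorem matCoeff_rowMonomial_some {a b c e i j : ℕ} (ha : a < p) (hb : b < p) (hc : c < p)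
    (he : e < p) (hi : i < p) (hj : j < p) (β : ZMod p) :
    matCoeff a b c e (rowMonomial (some β) i j) =
      if a + c = i ∧ b + e = j then (i.choose c * j.choose e : ZMod p) * β ^ (c + e) else 0 := by
  have := matCoeff_mul (p := p) a b c e (fun x z => (x + β * z) ^ i) (fun y w => (y + β * w) ^ j)
  rw [sum_coeffWeight_mul_add_pow ha hc hi, sum_coeffWeight_mul_add_pow hb he hj] at this
  refine this.trans ?_
  rw [ite_zero_mul_ite_zero]
  congr 1
  ring

/-- The same shape as for finite `β`, with `β ^ (c + e)` replaced by the indicator of top degree.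
There `c = i` and `e = j`, so the binomials equal `1`. -/
theorem matCoeff_rowMonomial_none {a b c e i j : ℕ} (ha : a < p) (hb : b < p) (hc : c < p)
    (he : e < p) (hi : i < p) (hj : j < p) :
    matCoeff a b c e (rowMonomial (none : Option (ZMod p)) i j) =
      if a + c = i ∧ b + e = j then (i.choose c * j.choose e : ZMod p) *
        (if c + e = i + j then 1 else 0) else 0 := by
  have h (a c i : ℕ) (ha : a < p) (hc : c < p) (hi : i < p) :
      ∑ x : ZMod p, ∑ z : ZMod p, coeffWeight a x * coeffWeight c z * z ^ i =
        if a = 0 ∧ c = i then 1 else 0 := by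
    have h0 := sum_coeffWeight_mul_pow ha (Fact.out : p.Prime).pos
    simp only [pow_zero, mul_one] at h0
    simp_rw [mul_assoc, ← Finset.mul_sum, ← Finset.sum_mul, h0, sum_coeffWeight_mul_pow hc hi,
      ite_zero_mul_ite_zero, mul_one]
  have := matCoeff_mul (p := p) a b c e (fun x z => z ^ i) (fun y w => w ^ j)
  rw [h a c i ha hc hi, h b e j hb he hj, ite_zero_mul_ite_zero] at this
  refine this.trans ?_
  by_cases h1 : (a = 0 ∧ c = i) ∧ b = 0 ∧ e = j
  · obtain ⟨⟨rfl, rfl⟩, rfl, rfl⟩ := h1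
    simp
  · rw [if_neg h1]
    split_ifs with h2 h3
    · omega
    all_goals simp

/-- The function on matrices with leading coefficient at row degree `κ`, of bidegree `(i, j)`. -/
def rowPoly (i j κ : ℕ) : Mat p → ZMod p :=
  if κ = 0 then rowMonomial (some 0) i j else if κ = p then rowMonomial none i j else
    -(∑ β : ZMod p, β ^ (p - 1 - κ) • rowMonomial (some β) i j) -
      if κ + (p - 1) = i + j then rowMonomial none i j else 0

/-- The coefficient of `rowPoly i j κ` in row degree `k`, up to binomial coefficients, where
`d = i + j`. -/
def rowPolyCoeff (p d κ k : ℕ) : ℕ :=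
  if κ = 0 then if k = 0 then 1 else 0 else if κ = p then if k = d then 1 else 0 else
    if k = κ ∨ (k = κ + (p - 1) ∧ k ≠ d) then 1 else 0

/-- A power-weighted sum over `β` is a discrete Fourier transform: it extracts the part whose degree
`c + e` in the second row has a given class modulo `p - 1`. The points `0` and infinity isolate
degrees `0` and `i + j`, and the point at infinity also removes the top degree from the middle
classes. -/
theorem matCoeff_rowPoly {a b c e i j κ : ℕ} (ha : a < p) (hb : b < p) (hc : c < p)
    (he : e < p) (hi : i < p) (hj : j < p) (hκ : κ ≤ p) :
    matCoeff a b c e (rowPoly (p := p) i j κ) =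
      if a + c = i ∧ b + e = j then (i.choose c * j.choose e : ZMod p) *
        (rowPolyCoeff p (i + j) κ (c + e) : ℕ) else 0 := by
  have hp := (Fact.out : p.Prime).two_le
  unfold rowPoly rowPolyCoeff
  by_cases h0 : κ = 0
  · simp only [if_pos h0]
    rw [matCoeff_rowMonomial_some ha hb hc he hi hj]
    congr 2
    by_cases h : c + e = 0
    · simp [h]
    · rw [zero_pow h, if_neg h, Nat.cast_zero]
  by_cases h1 : κ = p
  · simp only [if_neg h0, if_pos h1]
    rw [matCoeff_rowMonomial_none ha hb hc he hi hj]
    congr 2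
    by_cases h : c + e = i + j <;> simp [h]
  simp only [if_neg h0, if_neg h1]
  have h2 : matCoeff a b c e (if κ + (p - 1) = i + j then
      rowMonomial (none : Option (ZMod p)) i j else 0) =
      if κ + (p - 1) = i + j then matCoeff a b c e (rowMonomial (none : Option (ZMod p)) i j)
        else 0 := by
    split_ifs <;> simp
  rw [map_sub, map_neg, map_sum, h2]
  simp only [map_smul, matCoeff_rowMonomial_some ha hb hc he hi hj,
    matCoeff_rowMonomial_none ha hb hc he hi hj, smul_eq_mul]
  by_cases h : a + c = i ∧ b + e = j
  swap
  · simp [h]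
  simp only [if_pos h]
  have h3 : ∑ β : ZMod p, β ^ (p - 1 - κ) *
      ((i.choose c : ZMod p) * (j.choose e : ZMod p) * β ^ (c + e)) =
      (i.choose c * j.choose e) * ∑ β : ZMod p, β ^ (p - 1 - κ + (c + e)) := by
    rw [Finset.mul_sum]
    refine Finset.sum_congr rfl fun β _ => ?_
    rw [pow_add]; ring
  -- Since `0 < κ < p` and `c + e ≤ 2(p - 1)`, only the multiples `0`, `1`, `2` of `p - 1` can
  -- occur; `0` needs `κ = p - 1` and `c + e = 0`, and is excluded by positivity.
  have h4 : (0 < p - 1 - κ + (c + e) ∧ p - 1 ∣ p - 1 - κ + (c + e)) ↔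
      (c + e = κ ∨ c + e = κ + (p - 1)) := by
    constructor
    · rintro ⟨h5, k, hk⟩
      have : k < 3 := by
        by_contra! h
        have := Nat.mul_le_mul_left (p - 1) h
        omega
      interval_cases k <;> omega
    · rintro (h | h)
      · exact ⟨by omega, 1, by omega⟩
      · exact ⟨by omega, 2, by omega⟩
  rw [h3, sum_pow_eq]
  simp only [h4]
  by_cases h5 : c + e = κ
  · have h6 : ¬ (κ + (p - 1) = i + j ∧ c + e = i + j) := by omega
    by_cases h7 : κ + (p - 1) = i + j
    · simp [h5, h7, show κ ≠ i + j by omega]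
    · simp [h5, h7]
  · by_cases h7 : c + e = κ + (p - 1)
    · by_cases h8 : c + e = i + j
      · have h9 : κ + (p - 1) = i + j := by omega
        simp [h7, h9, show i + j ≠ κ by omega]
      · have h9 : ¬ κ + (p - 1) = i + j := by omega
        simp [h7, h9]
    · by_cases h9 : κ + (p - 1) = i + j
      · have h8 : c + e ≠ i + j := by omega
        simp [h5, h9, h8]
      · simp [h5, h7, h9]

end

end FullLevel

/-! ## The span of the affine planes is saturated at `p` -/

namespace FullLevel

/-- The indices `(i, j, κ)` of the functions `rowPoly i j κ`, for `false`, and of their transposes,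
for `true`, which occur in the independent family. -/
abbrev PolyIndex (p : ℕ) : Type :=
  {x : Bool × Fin p × Fin p × Fin (p + 1) //
    if x.1 then p ≤ x.2.1.val + x.2.2.1.val ∧
      (x.2.2.2.val + p ≤ x.2.1.val + x.2.2.1.val ∨ x.2.2.2.val = p)
    else x.2.2.2.val ≤ x.2.1.val + x.2.2.1.val}

/-- With `d = i + j`, the pair `(i, j)` contributes `d + 1` indices if `d < p`, and `(p + 1) + (d -
p + 2) = d + 3` if `d ≥ p`. The total is `p³ + p² - p`. -/
theorem card_polyIndex (p : ℕ) (hp : 0 < p) :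
    Fintype.card (PolyIndex p) = (p + 1) * (p ^ 2 - 1) + 1 := by
  have h (i j : Fin p) : ∑ κ : Fin (p + 1), (if κ.val ≤ i.val + j.val then 1 else 0) +
      ∑ κ : Fin (p + 1), (if p ≤ i.val + j.val ∧ (κ.val + p ≤ i.val + j.val ∨ κ.val = p)
        then 1 else 0) = i.val + j.val + 1 + 2 * if p ≤ i.val + j.val then 1 else 0 := by
    have h1 (P : ℕ → Prop) [DecidablePred P] : ∑ κ : Fin (p + 1), (if P κ.val then 1 else 0) =
        ((Finset.range (p + 1)).filter P).card := by
      rw [Fin.sum_univ_eq_sum_range (fun k => if P k then 1 else 0), Finset.card_filter]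
    rw [h1 (fun k => k ≤ i.val + j.val),
      h1 (fun k => p ≤ i.val + j.val ∧ (k + p ≤ i.val + j.val ∨ k = p))]
    by_cases hd : p ≤ i.val + j.val
    · have e1 : (Finset.range (p + 1)).filter (fun k => k ≤ i.val + j.val) =
          Finset.range (p + 1) := by
        ext k; simp only [Finset.mem_filter, Finset.mem_range]; omega
      have e2 : (Finset.range (p + 1)).filter
          (fun k => p ≤ i.val + j.val ∧ (k + p ≤ i.val + j.val ∨ k = p)) =
          insert p (Finset.range (i.val + j.val - p + 1)) := by
        ext k; simp only [Finset.mem_filter, Finset.mem_range, Finset.mem_insert]; omega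
      rw [e1, e2, Finset.card_insert_of_notMem (by simp; omega), Finset.card_range,
        Finset.card_range, if_pos hd]
      omega
    · have e1 : (Finset.range (p + 1)).filter (fun k => k ≤ i.val + j.val) =
          Finset.range (i.val + j.val + 1) := by
        ext k; simp only [Finset.mem_filter, Finset.mem_range]; omega
      rw [e1]
      simp [hd]
  have h2 (i : Fin p) : ∑ j : Fin p, (if p ≤ i.val + j.val then 1 else 0) = i.val := by
    rw [Fin.sum_univ_eq_sum_range (fun k => if p ≤ i.val + k then 1 else 0), ← Finset.card_filter]
    have : (Finset.range p).filter (fun k => p ≤ i.val + k) = Finset.Ico (p - i.val) p := by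
      ext k; simp only [Finset.mem_filter, Finset.mem_range, Finset.mem_Ico]; omega
    rw [this, Nat.card_Ico]
    omega
  have h3 : Fintype.card (PolyIndex p) =
      ∑ i : Fin p, ∑ j : Fin p, (i.val + j.val + 1 + 2 * if p ≤ i.val + j.val then 1 else 0) := by
    simp only [← h, Finset.sum_add_distrib]
    rw [Fintype.card_subtype, Finset.card_filter]
    simp only [Fintype.sum_prod_type, Fintype.sum_bool, if_true, Bool.false_eq_true, if_false]
    exact add_comm _ _
  have h4 : (∑ i : Fin p, i.val) * 2 = p * (p - 1) := by
    rw [Fin.sum_univ_eq_sum_range (fun i => i), Finset.sum_range_id_mul_two]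
  rw [h3]
  simp only [Finset.sum_add_distrib, ← Finset.mul_sum, h2, Finset.sum_const, Finset.card_univ,
    Fintype.card_fin, smul_eq_mul, mul_one]
  obtain ⟨q, rfl⟩ : ∃ q, p = q + 1 := ⟨p - 1, by omega⟩
  simp only [Nat.add_sub_cancel] at h4 ⊢
  have h5 : (q + 1) ^ 2 - 1 = q * (q + 2) := by
    rw [Nat.sub_eq_iff_eq_add (Nat.one_le_pow 2 (q + 1) hp)]; ring
  rw [h5]
  nlinarith

section

variable {p : ℕ} [Fact p.Prime]

/-- The span of the reductions modulo `p` of the elements of `planeSpan p`. -/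
def modPlaneSpan (p : ℕ) : Submodule (ZMod p) (Mat p → ZMod p) :=
  Submodule.span (ZMod p) {f | ∃ g ∈ planeSpan p, f = fun X => (g X : ZMod p)}

theorem comp_comb_mem_modPlaneSpan (F : Gam p → ZMod p) (a : Option (ZMod p)) :
    (fun X : Mat p => F (comb a X.1 X.2)) ∈ modPlaneSpan p := by
  have : (fun X : Mat p => F (comb a X.1 X.2)) =
      ∑ t : Gam p, F t • fun X : Mat p => ((rowInd a t X : ℤ) : ZMod p) := by
    ext X
    simp [Finset.sum_apply, rowInd]
  rw [this]
  exact sum_mem fun t _ => Submodule.smul_mem _ _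
    (Submodule.subset_span ⟨_, Submodule.subset_span (Or.inl ⟨a, t, rfl⟩), rfl⟩)

theorem comp_comb_tr_mem_modPlaneSpan (F : Gam p → ZMod p) (a : Option (ZMod p)) :
    (fun X : Mat p => F (comb a X.tr.1 X.tr.2)) ∈ modPlaneSpan p := by
  have : (fun X : Mat p => F (comb a X.tr.1 X.tr.2)) =
      ∑ t : Gam p, F t • fun X : Mat p => ((colInd a t X : ℤ) : ZMod p) := by
    ext X
    simp [Finset.sum_apply, rowInd, colInd]
  rw [this]
  exact sum_mem fun t _ => Submodule.smul_mem _ _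
    (Submodule.subset_span ⟨_, Submodule.subset_span (Or.inr ⟨a, t, rfl⟩), rfl⟩)

/-- The subspace `U` is arbitrary so that it may also be the preimage of `modPlaneSpan p` under
transposition. -/
theorem rowPoly_mem {U : Submodule (ZMod p) (Mat p → ZMod p)} {i j : ℕ}
    (h : ∀ a, rowMonomial a i j ∈ U) (κ : ℕ) : rowPoly i j κ ∈ U := by
  unfold rowPoly
  split_ifs
  · exact h _
  · exact h _
  · exact sub_mem (neg_mem (sum_mem fun β _ => U.smul_mem _ (h _))) (h _)
  · exact sub_mem (neg_mem (sum_mem fun β _ => U.smul_mem _ (h _))) U.zero_mem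

/-- The independent family of functions in the span of the affine planes. -/
def polyFamily (x : PolyIndex p) : Mat p → ZMod p :=
  if x.1.1 then rowPoly x.1.2.1 x.1.2.2.1 x.1.2.2.2 ∘ Mat.tr
    else rowPoly x.1.2.1 x.1.2.2.1 x.1.2.2.2

theorem polyFamily_mem (x : PolyIndex p) : polyFamily x ∈ modPlaneSpan p := by
  unfold polyFamily
  split_ifs
  · exact rowPoly_mem (U := (modPlaneSpan p).comap (LinearMap.funLeft (ZMod p) (ZMod p) Mat.tr))
      (fun a => comp_comb_tr_mem_modPlaneSpan (fun t => t.1 ^ x.1.2.1.val * t.2 ^ x.1.2.2.1.val) a)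
      _
  · exact rowPoly_mem
      (fun a => comp_comb_mem_modPlaneSpan (fun t => t.1 ^ x.1.2.1.val * t.2 ^ x.1.2.2.1.val) a) _

/-- The coefficient functional on functions on matrices dual to a member of `polyFamily`. -/
noncomputable def polyFunctional (x : PolyIndex p) : (Mat p → ZMod p) →ₗ[ZMod p] ZMod p :=
  let i := x.1.2.1.val
  let j := x.1.2.2.1.val
  let k := if x.1.2.2.2.val = p then i + j else x.1.2.2.2.val
  let c := min i k
  if x.1.1 then matCoeff (i - c) c (j - (k - c)) (k - c) else
    matCoeff (i - c) (j - (k - c)) c (k - c)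

theorem cast_choose_ne_zero {i c : ℕ} (hi : i < p) (hc : c ≤ i) : (i.choose c : ZMod p) ≠ 0 := by
  rw [Ne, ZMod.natCast_eq_zero_iff]
  intro h
  have h1 := Nat.choose_mul_factorial_mul_factorial hc
  have h2 : p ∣ i.factorial := by
    rw [← h1, mul_assoc]; exact h.mul_right _
  exact absurd ((Fact.out : p.Prime).dvd_factorial.1 h2) (by omega)

/-- The test monomial has second-row degree `κ`, or `i + j` when `κ = p`. Any other `rowPoly` with
the same column degrees `(i, j)` vanishes there: its possible extra degree `κ' + (p - 1)` is at
least `p`, and is dropped if it equals `i + j`. -/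
theorem matCoeff_rowPoly_eq_zero {i j κ i' j' κ' c : ℕ} (hi : i < p) (hj : j < p) (hκ : κ ≤ p)
    (hi' : i' < p) (hj' : j' < p) (hκ' : κ' ≤ p) (h : κ ≤ i + j) (h' : κ' ≤ i' + j')
    (hne : ¬ (i = i' ∧ j = j' ∧ κ = κ')) {k : ℕ} (hk : k = if κ = p then i + j else κ)
    (hc : c = min i k) :
    matCoeff (i - c) (j - (k - c)) c (k - c) (rowPoly (p := p) i' j' κ') = 0 := by
  have hk' : k ≤ i + j := by split_ifs at hk <;> omega
  rw [matCoeff_rowPoly (by omega) (by omega) (by omega) (by omega) hi' hj' hκ']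
  by_cases h1 : i - c + c = i' ∧ j - (k - c) + (k - c) = j'
  · have e1 : i = i' := by omega
    have e2 : j = j' := by omega
    subst e1 e2
    have : rowPolyCoeff p (i + j) κ' (c + (k - c)) = 0 := by
      unfold rowPolyCoeff
      split_ifs at * <;> omega
    rw [this]; simp
  · rw [if_neg h1]

theorem matCoeff_rowPoly_ne_zero {i j κ c : ℕ} (hi : i < p) (hj : j < p) (hκ : κ ≤ p)
    (h : κ ≤ i + j) {k : ℕ} (hk : k = if κ = p then i + j else κ) (hc : c = min i k) :
    matCoeff (i - c) (j - (k - c)) c (k - c) (rowPoly (p := p) i j κ) ≠ 0 := by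
  have hk' : k ≤ i + j := by split_ifs at hk <;> omega
  rw [matCoeff_rowPoly (by omega) (by omega) (by omega) (by omega) hi hj hκ]
  have : rowPolyCoeff p (i + j) κ (c + (k - c)) = 1 := by
    unfold rowPolyCoeff
    split_ifs at * <;> omega
  rw [if_pos (by omega), this, Nat.cast_one, mul_one]
  exact mul_ne_zero (cast_choose_ne_zero hi (by omega)) (cast_choose_ne_zero hj (by omega))

theorem polyFunctional_polyFamily_self (x : PolyIndex p) : polyFunctional x (polyFamily x) ≠ 0 := by
  obtain ⟨⟨b, i, j, κ⟩, hx⟩ := x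
  cases b
  · simp only [Bool.false_eq_true, if_false] at hx
    simp only [polyFunctional, polyFamily, Bool.false_eq_true, if_false]
    exact matCoeff_rowPoly_ne_zero i.2 j.2 (by omega) hx rfl rfl
  · simp only [if_true] at hx
    simp only [polyFunctional, polyFamily, if_true, matCoeff_comp_tr]
    exact matCoeff_rowPoly_ne_zero i.2 j.2 (by omega) (by omega) rfl rfl

theorem polyFunctional_polyFamily {x y : PolyIndex p} (hxy : x ≠ y) :
    polyFunctional x (polyFamily y) = 0 := by
  obtain ⟨⟨b, i, j, κ⟩, hx⟩ := x
  obtain ⟨⟨b', i', j', κ'⟩, hy⟩ := y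
  have hne (h : b = b') : ¬ (i.val = i'.val ∧ j.val = j'.val ∧ κ.val = κ'.val) := by
    rintro ⟨h1, h2, h3⟩
    obtain rfl := Fin.ext h1
    obtain rfl := Fin.ext h2
    obtain rfl := Fin.ext h3
    subst h
    exact hxy rfl
  have := i.2
  have := j.2
  have := i'.2
  have := j'.2
  have := κ.2
  have := κ'.2
  cases b <;> cases b' <;> simp only [Bool.false_eq_true, if_false, if_true] at hx hy <;>
    simp only [polyFunctional, polyFamily, Bool.false_eq_true, if_false, if_true,
      matCoeff_comp_tr]
  · exact matCoeff_rowPoly_eq_zero i.2 j.2 (by omega) i'.2 j'.2 (by omega) hx hy (hne rfl) rfl rfl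
  -- Row monomial tested on a transposed polynomial: matching degrees gives `i + j = i' + j' ≥ p`,
  -- and the coefficient is read in degree `j < p`. If it were nonzero, `κ' = p` would give `j ≥ p`,
  -- while `κ' + p ≤ i' + j'` would force `j = κ'` and so `i ≥ p`.
  · have hk : (if κ.val = p then i.val + j.val else κ.val) ≤ i.val + j.val := by
      split_ifs <;> omega
    generalize (if κ.val = p then i.val + j.val else κ.val) = k at hk
    rw [matCoeff_rowPoly (by omega) (by omega) (by omega) (by omega) i'.2 j'.2 (by omega)]
    split_ifs with h
    · have : rowPolyCoeff p (i'.val + j'.val) κ'.val (j.val - (k - min i.val k) + (k - min i.val k)) =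
          0 := by
        unfold rowPolyCoeff
        split_ifs <;> omega
      rw [this]; simp
    · rfl
  -- Transposed monomial tested on a row polynomial: its column degrees are `i + j - k` and `k`, one
  -- of which is at least `p`, whereas those of the polynomial are `i', j' < p`.
  · have hk : (if κ.val = p then i.val + j.val else κ.val) ≤ i.val + j.val ∧
        (p ≤ (if κ.val = p then i.val + j.val else κ.val) ∨
        (if κ.val = p then i.val + j.val else κ.val) + p ≤ i.val + j.val) := by
      split_ifs <;> omega
    generalize (if κ.val = p then i.val + j.val else κ.val) = k at hk
    rw [matCoeff_rowPoly (by omega) (by omega) (by omega) (by omega) i'.2 j'.2 (by omega)]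
    rw [if_neg (by omega)]
  · exact matCoeff_rowPoly_eq_zero i.2 j.2 (by omega) i'.2 j'.2 (by omega) (by omega) (by omega)
      (hne rfl) rfl rfl

theorem linearIndependent_polyFamily : LinearIndependent (ZMod p) (polyFamily (p := p)) := by
  rw [Fintype.linearIndependent_iff]
  intro g hg x
  have := congrArg (polyFunctional x) hg
  rw [map_sum, map_zero, Finset.sum_eq_single x] at this
  · rw [map_smul, smul_eq_mul] at this
    exact (mul_eq_zero.1 this).resolve_right (polyFunctional_polyFamily_self x)
  · intro y _ hy
    rw [map_smul, polyFunctional_polyFamily hy.symm, smul_zero]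
  · simp

theorem le_finrank_modPlaneSpan :
    (p + 1) * (p ^ 2 - 1) + 1 ≤ Module.finrank (ZMod p) (modPlaneSpan p) := by
  rw [← card_polyIndex p (Fact.out : p.Prime).pos]
  have : LinearIndependent (ZMod p) fun x : PolyIndex p =>
      (⟨polyFamily x, polyFamily_mem x⟩ : modPlaneSpan p) :=
    LinearIndependent.of_comp (modPlaneSpan p).subtype linearIndependent_polyFamily
  exact this.fintype_card_le_finrank

/-- The reductions of a `ℤ`-basis span a space of dimension at least their number, so they are
independent. The coordinates of `p • f` vanish modulo `p`, hence are divisible by `p`. -/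
theorem mem_planeSpan_of_smul_mem {f : Mat p → ℤ} (hf : (p : ℤ) • f ∈ planeSpan p) :
    f ∈ planeSpan p := by
  have hp : (p : ℤ) ≠ 0 := by exact_mod_cast (Fact.out : p.Prime).ne_zero
  let b := Module.finBasis ℤ (planeSpan p)
  let v : Fin (Module.finrank ℤ (planeSpan p)) → Mat p → ZMod p :=
    fun i X => ((b i : Mat p → ℤ) X : ZMod p)
  have hsum (g : planeSpan p) : (fun X => ((g : Mat p → ℤ) X : ZMod p)) =
      ∑ i, (b.repr g i : ZMod p) • v i := by
    ext X
    have h := congrArg (fun g : planeSpan p => ((g : Mat p → ℤ) X : ZMod p)) (b.sum_repr g)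
    refine h.symm.trans ?_
    simp [v, Finset.sum_apply, -Module.Basis.sum_repr]
  have hspan : modPlaneSpan p ≤ Submodule.span (ZMod p) (Set.range v) := by
    refine Submodule.span_le.2 ?_
    rintro _ ⟨g, hg, rfl⟩
    rw [SetLike.mem_coe, hsum ⟨g, hg⟩]
    exact sum_mem fun i _ => Submodule.smul_mem _ _ (Submodule.subset_span ⟨i, rfl⟩)
  have hv : LinearIndependent (ZMod p) v := by
    rw [linearIndependent_iff_card_le_finrank_span, Fintype.card_fin, Set.finrank]
    exact finrank_planeSpan_le.trans
      (le_finrank_modPlaneSpan.trans (Submodule.finrank_mono hspan))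
  rw [Fintype.linearIndependent_iff] at hv
  have h0 := hv (fun i => (b.repr ⟨_, hf⟩ i : ZMod p)) (by
    rw [← hsum]
    ext X
    simp)
  choose c hc using fun i => (ZMod.intCast_zmod_eq_zero_iff_dvd _ _).1 (h0 i)
  have h1 : (p : ℤ) • f = (p : ℤ) • ∑ i, c i • (b i : Mat p → ℤ) := by
    have := congrArg Subtype.val (b.sum_repr ⟨_, hf⟩)
    refine this.symm.trans ?_
    simp only [hc, Submodule.coe_sum, Submodule.coe_smul, mul_smul, Finset.smul_sum]
  rw [smul_right_injective _ hp h1]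
  exact sum_mem fun i _ => Submodule.smul_mem _ _ (b i).2

end

end FullLevel

/-! ## The universal pairing with orthogonality relations -/

namespace FullLevel

/-- A bimultiplicative pairing on `(ℤ/p)²` whose nontrivial rows and columns sum to zero. -/
structure IsFullPairing {p : ℕ} [NeZero p] {R : Type*} [CommRing R] (χ : Gam p → Gam p → R) :
    Prop where
  zero_left : ∀ a, χ 0 a = 1
  add_left : ∀ g g' a, χ (g + g') a = χ g a * χ g' a
  zero_right : ∀ g, χ g 0 = 1
  add_right : ∀ g a a', χ g (a + a') = χ g a * χ g a'
  sum_left : ∀ a ≠ 0, ∑ g, χ g a = 0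
  sum_right : ∀ g ≠ 0, ∑ a, χ g a = 0

namespace IsFullPairing

variable {p : ℕ} [NeZero p] {R : Type*} [CommRing R] {χ : Gam p → Gam p → R}

theorem map (h : IsFullPairing χ) {R' : Type*} [CommRing R'] (φ : R →+* R') :
    IsFullPairing fun g a => φ (χ g a) where
  zero_left a := by rw [h.zero_left, map_one]
  add_left g g' a := by rw [h.add_left, map_mul]
  zero_right g := by rw [h.zero_right, map_one]
  add_right g a a' := by rw [h.add_right, map_mul]
  sum_left a ha := by rw [← map_sum, h.sum_left a ha, map_zero]
  sum_right g hg := by rw [← map_sum, h.sum_right g hg, map_zero]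

theorem symm (h : IsFullPairing χ) : IsFullPairing fun g a => χ a g :=
  ⟨h.zero_right, fun g g' a => h.add_right a g g', h.zero_left, fun g a a' => h.add_left a a' g,
    h.sum_right, h.sum_left⟩

theorem smul_left_eq (h : IsFullPairing χ) (k : ZMod p) (g a : Gam p) :
    χ (k • g) a = χ g (k • a) := by
  have h1 (n : ℕ) : χ (n • g) a = χ g (n • a) := by
    induction n with
    | zero => rw [zero_smul, zero_smul, h.zero_left, h.zero_right]
    | succ n ih => rw [add_smul, add_smul, one_smul, one_smul, h.add_left, h.add_right, ih]
  rw [← ZMod.natCast_zmod_val k, Nat.cast_smul_eq_nsmul, Nat.cast_smul_eq_nsmul, h1]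

/-- If `p` is not a zero divisor, the determinant of multiplication by an element of the group
algebra is the product of the values of that element. -/
theorem det_eq_prod_of_nonZeroDivisors (h : IsFullPairing χ)
    (hp : (p : R) ∈ nonZeroDivisors R) (c : Gam p → R) :
    (Matrix.of fun g' g => c (g' - g)).det = ∏ a, ∑ g, c g * χ g a := by
  set L : Matrix (Gam p) (Gam p) R := Matrix.of fun g' g => c (g' - g)
  let M : Matrix (Gam p) (Gam p) R := Matrix.of fun a g => χ g a
  let M' : Matrix (Gam p) (Gam p) R := Matrix.of fun g a => χ g (-a)
  -- Orthogonality of characters: the `(a, b)` entry is the sum over `g` of `χ g (a - b)`.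
  have hM : M * M' = ((p : R) * p) • (1 : Matrix (Gam p) (Gam p) R) := by
    ext a b
    simp only [M, M', Matrix.mul_apply, Matrix.of_apply, ← h.add_right, ← sub_eq_add_neg,
      Matrix.smul_apply, smul_eq_mul]
    by_cases hab : a = b
    · subst hab
      simp [h.zero_right, ZMod.card]
    · rw [h.sum_left _ (sub_ne_zero.2 hab), Matrix.one_apply_ne hab, mul_zero]
  -- The rows of the character table are left eigenvectors of the multiplication matrix, by
  -- multiplicativity in `g`.
  have hL : M * L = Matrix.diagonal (fun a => ∑ g, c g * χ g a) * M := by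
    ext a g
    rw [Matrix.diagonal_mul, Finset.sum_mul]
    simp only [M, L, Matrix.mul_apply, Matrix.of_apply]
    refine Fintype.sum_equiv (Equiv.subRight g) _ _ fun k => ?_
    rw [Equiv.subRight_apply, mul_assoc, ← h.add_left, sub_add_cancel, mul_comm]
  have h1 : M.det * L.det = (∏ a, ∑ g, c g * χ g a) * M.det := by
    rw [← Matrix.det_mul, hL, Matrix.det_mul, Matrix.det_diagonal]
  have h2 : M.det * M'.det ∈ nonZeroDivisors R := by
    rw [← Matrix.det_mul, hM, Matrix.det_smul, Matrix.det_one, mul_one]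
    exact pow_mem (mul_mem hp hp) _
  refine (mul_cancel_left_mem_nonZeroDivisors h2).1 ?_
  linear_combination M'.det * h1

end IsFullPairing

/-- The matrix `(a_i g_j)` attached to `g` and `a`. -/
def outer {p : ℕ} (g a : Gam p) : Mat p := (a.1 • g, a.2 • g)

theorem tr_outer {p : ℕ} (g a : Gam p) : (outer g a).tr = outer a g := by
  simp [Mat.tr, outer, Prod.ext_iff, mul_comm]

section

variable (p : ℕ) [NeZero p]

/-- The ideal of the orthogonality relations in the group algebra of the group of matrices. -/
noncomputable def orthIdeal : Ideal (AddMonoidAlgebra ℤ (Mat p)) :=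
  Ideal.span ({f | ∃ a ≠ 0, f = ∑ g : Gam p, AddMonoidAlgebra.single (outer g a) 1} ∪
    {f | ∃ g ≠ 0, f = ∑ a : Gam p, AddMonoidAlgebra.single (outer g a) 1})

/-- The universal ring carrying a full pairing. -/
abbrev OrthRing : Type := AddMonoidAlgebra ℤ (Mat p) ⧸ orthIdeal p

/-- The universal full pairing. -/
noncomputable def orthPairing (g a : Gam p) : OrthRing p :=
  Ideal.Quotient.mk _ (AddMonoidAlgebra.single (outer g a) 1)

theorem isFullPairing_orthPairing : IsFullPairing (orthPairing p) where
  zero_left a := by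
    have : outer 0 a = 0 := by simp [outer]
    rw [orthPairing, this]
    exact map_one _
  zero_right g := by
    have : outer g 0 = 0 := by simp [outer]
    rw [orthPairing, this]
    exact map_one _
  add_left g g' a := by
    have : outer (g + g') a = outer g a + outer g' a := by simp [outer]
    simp only [orthPairing, ← map_mul, AddMonoidAlgebra.single_mul_single, this, mul_one]
  add_right g a a' := by
    have : outer g (a + a') = outer g a + outer g a' := by simp [outer, add_smul]
    simp only [orthPairing, ← map_mul, AddMonoidAlgebra.single_mul_single, this, mul_one]
  sum_left a ha := by
    simp only [orthPairing, ← map_sum]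
    exact Ideal.Quotient.eq_zero_iff_mem.2 (Ideal.subset_span (Or.inl ⟨a, ha, rfl⟩))
  sum_right g hg := by
    simp only [orthPairing, ← map_sum]
    exact Ideal.Quotient.eq_zero_iff_mem.2 (Ideal.subset_span (Or.inr ⟨g, hg, rfl⟩))

variable {p}

/-- The homomorphism from the universal ring attached to a full pairing. -/
theorem IsFullPairing.exists_hom {R : Type*} [CommRing R] {χ : Gam p → Gam p → R}
    (h : IsFullPairing χ) : ∃ φ : OrthRing p →+* R, ∀ g a, φ (orthPairing p g a) = χ g a := by
  -- A full pairing is determined by its values at the two basis vectors `(1, 0)` and `(0, 1)`, one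
  -- for each row of `X`.
  let ψ : AddMonoidAlgebra ℤ (Mat p) →ₐ[ℤ] R := AddMonoidAlgebra.lift ℤ R (Mat p)
    { toFun := fun X => χ X.toAdd.1 (1, 0) * χ X.toAdd.2 (0, 1)
      map_one' := by simp [h.zero_left]
      map_mul' := fun X Y => by
        simp only [toAdd_mul, Prod.fst_add, Prod.snd_add, h.add_left]; ring }
  have hψ (g a : Gam p) : ψ (AddMonoidAlgebra.single (outer g a) 1) = χ g a := by
    simp only [ψ, AddMonoidAlgebra.lift_single, MonoidHom.coe_mk, OneHom.coe_mk, toAdd_ofAdd,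
      outer, one_smul, h.smul_left_eq, ← h.add_right]
    simp
  refine ⟨Ideal.Quotient.lift _ (ψ : AddMonoidAlgebra ℤ (Mat p) →+* R) ?_, hψ⟩
  suffices orthIdeal p ≤ RingHom.ker (ψ : AddMonoidAlgebra ℤ (Mat p) →+* R) from fun a ha => this ha
  refine Ideal.span_le.2 ?_
  rintro _ (⟨a, ha, rfl⟩ | ⟨g, hg, rfl⟩)
  · simp [RingHom.mem_ker, hψ, h.sum_left a ha]
  · simp [RingHom.mem_ker, hψ, h.sum_right g hg]

end

/-! ### Torsion-freeness of the universal ring, and the determinant identity -/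

section

variable {p : ℕ} [Fact p.Prime]

/-- The coefficients of an element of the group algebra of the group of matrices. -/
noncomputable def coeffFun (p : ℕ) [NeZero p] :
    AddMonoidAlgebra ℤ (Mat p) ≃ₗ[ℤ] (Mat p → ℤ) :=
  (AddMonoidAlgebra.coeffLinearEquiv ℤ).trans (Finsupp.linearEquivFunOnFinite ℤ ℤ (Mat p))

theorem coeffFun_single (X Y : Mat p) (r : ℤ) :
    coeffFun p (AddMonoidAlgebra.single X r) Y = if X = Y then r else 0 := by
  change (AddMonoidAlgebra.single X r).coeff Y = _
  rw [AddMonoidAlgebra.coeff_single, Finsupp.single_apply]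

theorem coeffFun_single_mul (X Y : Mat p) (r : ℤ) (f : AddMonoidAlgebra ℤ (Mat p)) :
    coeffFun p (AddMonoidAlgebra.single X r * f) Y = r * coeffFun p f (Y - X) := by
  induction f using AddMonoidAlgebra.induction_linear with
  | zero => simp
  | add f g hf hg => rw [mul_add, map_add, map_add, Pi.add_apply, Pi.add_apply, hf, hg, mul_add]
  | single Z s =>
    rw [AddMonoidAlgebra.single_mul_single, coeffFun_single, coeffFun_single]
    simp only [eq_sub_iff_add_eq, add_comm X Z, mul_ite, mul_zero]

theorem comb_sub (a : Option (ZMod p)) (X Y : Mat p) :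
    comb a (X - Y).1 (X - Y).2 = comb a X.1 X.2 - comb a Y.1 Y.2 := by
  cases a
  · rfl
  · simp only [comb, Option.elim, Prod.fst_sub, Prod.snd_sub, smul_sub]; abel

theorem translate_mem_planeSpan (Y : Mat p) {f : Mat p → ℤ} (hf : f ∈ planeSpan p) :
    (fun X => f (X - Y)) ∈ planeSpan p := by
  suffices planeSpan p ≤ (planeSpan p).comap (LinearMap.funLeft ℤ ℤ fun X => X - Y) from this hf
  have h (a t) (Y : Mat p) : (fun X => rowInd a t (X - Y)) = rowInd a (t + comb a Y.1 Y.2) := by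
    ext X
    simp only [rowInd, comb_sub, sub_eq_iff_eq_add]
  refine Submodule.span_le.2 ?_
  rintro _ (⟨a, t, rfl⟩ | ⟨a, t, rfl⟩)
  · exact Submodule.subset_span (Or.inl ⟨a, _, h a t Y⟩)
  · exact Submodule.subset_span (Or.inr ⟨a, _, congrArg (· ∘ Mat.tr) (h a t Y.tr)⟩)

/-- For fixed `a ≠ 0`, the matrices `outer g a` are exactly those whose rows satisfy the linear
relation satisfied by the entries of `a`; `g` is recovered by dividing a row by a nonzero entry of
`a`. -/
theorem sum_ite_outer {a : Gam p} (ha : a ≠ 0) : ∃ b : Option (ZMod p), ∀ X : Mat p,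
    ∑ g : Gam p, (if outer g a = X then (1 : ℤ) else 0) = rowInd b 0 X := by
  have key (b : Option (ZMod p)) (f : Mat p → Gam p)
      (hf : ∀ g X, outer g a = X ↔ comb b X.1 X.2 = 0 ∧ g = f X) (X : Mat p) :
      ∑ g : Gam p, (if outer g a = X then (1 : ℤ) else 0) = rowInd b 0 X := by
    simp only [hf, rowInd]
    by_cases h : comb b X.1 X.2 = 0 <;> simp [h]
  by_cases h2 : a.2 = 0
  · have h1 : a.1 ≠ 0 := fun h => ha (Prod.ext h h2)
    refine ⟨none, key none (fun X => a.1⁻¹ • X.1) fun g X => ?_⟩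
    constructor
    · rintro rfl
      simp [comb, outer, h2, smul_smul, inv_mul_cancel₀ h1]
    · rintro ⟨h, rfl⟩
      refine Prod.ext ?_ ?_
      · simp [outer, smul_smul, mul_inv_cancel₀ h1]
      · simpa [outer, h2, comb] using h.symm
  · refine ⟨some (-(a.1 * a.2⁻¹)), key _ (fun X => a.2⁻¹ • X.2) fun g X => ?_⟩
    constructor
    · rintro rfl
      simp [comb, outer, smul_smul, inv_mul_cancel₀ h2, mul_assoc]
    · rintro ⟨h, rfl⟩
      refine Prod.ext ?_ ?_
      · simp only [comb, Option.elim, neg_smul, add_neg_eq_zero] at h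
        simp [outer, smul_smul, h]
      · simp [outer, smul_smul, mul_inv_cancel₀ h2]

/-- The generators are planes through `0`. Multiplication by a group element is translation, which
permutes the planes in each direction. -/
theorem coeffFun_mem_planeSpan {f : AddMonoidAlgebra ℤ (Mat p)} (hf : f ∈ orthIdeal p) :
    coeffFun p f ∈ planeSpan p := by
  refine Submodule.span_induction (p := fun f _ => coeffFun p f ∈ planeSpan p) ?_ ?_ ?_ ?_ hf
  · rintro _ (⟨a, ha, rfl⟩ | ⟨g, hg, rfl⟩)
    · obtain ⟨b, hb⟩ := sum_ite_outer ha
      refine Submodule.subset_span (Or.inl ⟨b, 0, ?_⟩)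
      ext X
      rw [← hb, map_sum, Finset.sum_apply]
      simp only [coeffFun_single]
    · obtain ⟨b, hb⟩ := sum_ite_outer hg
      refine Submodule.subset_span (Or.inr ⟨b, 0, ?_⟩)
      ext X
      rw [colInd, ← hb, map_sum, Finset.sum_apply]
      simp only [coeffFun_single]
      refine Finset.sum_congr rfl fun a _ => ?_
      rw [← tr_outer g a]
      exact if_congr ⟨fun h => by rw [h], fun h => congrArg Mat.tr h⟩ rfl rfl
  · rw [map_zero]; exact zero_mem _
  · intro f g _ _ hf hg
    rw [map_add]; exact add_mem hf hg
  · intro r f _ hf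
    rw [smul_eq_mul]
    induction r using AddMonoidAlgebra.induction_linear with
    | zero => rw [zero_mul, map_zero]; exact zero_mem _
    | add r s hr hs => rw [add_mul, map_add]; exact add_mem hr hs
    | single Y s =>
      have : coeffFun p (AddMonoidAlgebra.single Y s * f) = s • fun X => coeffFun p f (X - Y) := by
        ext X
        simp [coeffFun_single_mul]
      rw [this]
      exact Submodule.smul_mem _ _ (translate_mem_planeSpan Y hf)

theorem exists_rowInd_eq (b : Option (ZMod p)) (t : Gam p) : ∃ a : Gam p, a ≠ 0 ∧ ∃ Y : Mat p,
    ∀ X, rowInd b t X = ∑ g : Gam p, if Y + outer g a = X then (1 : ℤ) else 0 := by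
  cases b with
  | none =>
    refine ⟨(1, 0), by simp, (0, t), fun X => ?_⟩
    have h (g : Gam p) : ((0, t) + outer g (1, 0) = X) ↔ X.2 = t ∧ g = X.1 := by
      simp [outer, Prod.ext_iff (y := X), and_comm, eq_comm]
    simp only [h, rowInd, comb, Option.elim]
    by_cases h : X.2 = t <;> simp [h]
  | some β =>
    refine ⟨(-β, 1), by simp, (t, 0), fun X => ?_⟩
    have h (g : Gam p) : ((t, 0) + outer g (-β, 1) = X) ↔ X.1 + β • X.2 = t ∧ g = X.2 := by
      have : ((t, 0) + outer g (-β, 1) = X) ↔ t - β • g = X.1 ∧ g = X.2 := by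
        simp [outer, Prod.ext_iff (y := X), sub_eq_add_neg]
      rw [this]
      constructor
      · rintro ⟨h1, rfl⟩
        exact ⟨by rw [← h1, sub_add_cancel], rfl⟩
      · rintro ⟨h1, rfl⟩
        exact ⟨by rw [← h1, add_sub_cancel_right], rfl⟩
    simp only [h, rowInd, comb, Option.elim]
    by_cases h : X.1 + β • X.2 = t <;> simp [h]

/-- Every plane is a translate of one through `0`, hence a monomial times a generator of the ideal.
-/
theorem mem_orthIdeal_of_coeffFun_mem {f : AddMonoidAlgebra ℤ (Mat p)}
    (hf : coeffFun p f ∈ planeSpan p) : f ∈ orthIdeal p := by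
  suffices planeSpan p ≤ ((orthIdeal p).restrictScalars ℤ).comap
      (coeffFun p).symm.toLinearMap by
    have := this hf
    simpa using this
  refine Submodule.span_le.2 ?_
  rintro _ (⟨b, t, rfl⟩ | ⟨b, t, rfl⟩)
  · obtain ⟨a, ha, Y, hY⟩ := exists_rowInd_eq b t
    have : (coeffFun p).symm (rowInd b t) = AddMonoidAlgebra.single Y 1 *
        ∑ g : Gam p, AddMonoidAlgebra.single (outer g a) 1 := by
      rw [LinearEquiv.symm_apply_eq]
      ext X
      rw [hY, Finset.mul_sum, map_sum, Finset.sum_apply]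
      simp only [AddMonoidAlgebra.single_mul_single, coeffFun_single, mul_one]
    change (coeffFun p).symm (rowInd b t) ∈ orthIdeal p
    rw [this]
    exact Ideal.mul_mem_left _ _ (Ideal.subset_span (Or.inl ⟨a, ha, rfl⟩))
  · obtain ⟨g, hg, Y, hY⟩ := exists_rowInd_eq b t
    have : (coeffFun p).symm (colInd b t) = AddMonoidAlgebra.single Y.tr 1 *
        ∑ a : Gam p, AddMonoidAlgebra.single (outer g a) 1 := by
      rw [LinearEquiv.symm_apply_eq]
      ext X
      rw [colInd, hY, Finset.mul_sum, map_sum, Finset.sum_apply]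
      simp only [AddMonoidAlgebra.single_mul_single, coeffFun_single, mul_one]
      refine Finset.sum_congr rfl fun a _ => ?_
      rw [← tr_outer g a]
      exact if_congr ⟨fun h => congrArg Mat.tr h, fun h => congrArg Mat.tr h⟩ rfl rfl
    change (coeffFun p).symm (colInd b t) ∈ orthIdeal p
    rw [this]
    exact Ideal.mul_mem_left _ _ (Ideal.subset_span (Or.inr ⟨g, hg, rfl⟩))

theorem natCast_mem_nonZeroDivisors_orthRing : (p : OrthRing p) ∈ nonZeroDivisors (OrthRing p) := by
  refine mem_nonZeroDivisors_iff_right.2 fun x hx => ?_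
  obtain ⟨f, rfl⟩ := Ideal.Quotient.mk_surjective x
  rw [← map_natCast (Ideal.Quotient.mk (orthIdeal p)), ← map_mul,
    Ideal.Quotient.eq_zero_iff_mem] at hx
  refine Ideal.Quotient.eq_zero_iff_mem.2
    (mem_orthIdeal_of_coeffFun_mem (mem_planeSpan_of_smul_mem ?_))
  rw [← map_smul]
  have : (p : ℤ) • f = f * (p : AddMonoidAlgebra ℤ (Mat p)) := by
    rw [zsmul_eq_mul, Int.cast_natCast, mul_comm]
  rw [this]
  exact coeffFun_mem_planeSpan hx

theorem natCast_mem_nonZeroDivisors_mvPolynomial {σ A : Type*} [CommRing A] {n : ℕ}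
    (h : (n : A) ∈ nonZeroDivisors A) :
    (n : MvPolynomial σ A) ∈ nonZeroDivisors (MvPolynomial σ A) := by
  refine mem_nonZeroDivisors_iff_right.2 fun x hx => MvPolynomial.ext _ _ fun m => ?_
  have := congrArg (MvPolynomial.coeff m) hx
  rw [mul_comm, ← map_natCast MvPolynomial.C, MvPolynomial.coeff_C_mul, MvPolynomial.coeff_zero,
    mul_comm] at this
  exact mem_nonZeroDivisors_iff_right.1 h _ this

/-- The coefficients `c` need not lift to `A`, so the identity is proved for indeterminate
coefficients over `A` and then specialized. -/
theorem IsFullPairing.det_eq_prod_of_hom {A R : Type*} [CommRing A] [CommRing R]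
    {χ : Gam p → Gam p → A} (h : IsFullPairing χ) (hp : (p : A) ∈ nonZeroDivisors A) (φ : A →+* R)
    (c : Gam p → R) :
    (Matrix.of fun g' g => c (g' - g)).det = ∏ a, ∑ g, c g * φ (χ g a) := by
  have key := congrArg (MvPolynomial.eval₂Hom φ c)
    ((h.map MvPolynomial.C).det_eq_prod_of_nonZeroDivisors
      (natCast_mem_nonZeroDivisors_mvPolynomial hp) MvPolynomial.X)
  rw [RingHom.map_det] at key
  simp only [map_prod, map_sum, map_mul, MvPolynomial.eval₂Hom_X', MvPolynomial.eval₂Hom_C]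
    at key
  rw [← key]
  congr 1
  ext g' g
  simp

/-- The determinant of multiplication by an element of the group algebra of `(ℤ/p)²` is the product
of the values of that element under a full pairing. -/
theorem IsFullPairing.det_eq_prod {R : Type*} [CommRing R] {χ : Gam p → Gam p → R}
    (h : IsFullPairing χ) (c : Gam p → R) :
    (Matrix.of fun g' g => c (g' - g)).det = ∏ a, ∑ g, c g * χ g a := by
  obtain ⟨φ, hφ⟩ := h.exists_hom
  have key := (isFullPairing_orthPairing p).det_eq_prod_of_hom
    natCast_mem_nonZeroDivisors_orthRing φ c
  simpa only [hφ] using key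

end

end FullLevel

/-! ## `×`-homomorphisms between group algebras and rings of functions -/

namespace FullLevel

section Charpoly

variable {R : Type*} [CommRing R]

theorem charpoly_lmul_group {Γ : Type*} [AddCommGroup Γ] [Fintype Γ] [DecidableEq Γ]
    {B : Type*} [CommRing B] [Algebra R B] [Module.Free R B] [Module.Finite R B]
    (b : Module.Basis Γ R B) (hb : ∀ g g', b g * b g' = b (g + g')) (c : Γ → R) :
    (Algebra.lmul R B (∑ g, c g • b g)).charpoly =
      (Matrix.of fun g' g => c (g' - g)).charpoly := by
  rw [← LinearMap.charpoly_toMatrix _ b]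
  congr 1
  ext g' g
  rw [LinearMap.toMatrix_apply]
  change b.repr ((∑ k, c k • b k) * b g) g' = c (g' - g)
  rw [Finset.sum_mul]
  simp only [smul_mul_assoc, hb, map_sum, map_smul, Module.Basis.repr_self,
    Finsupp.coe_finsetSum, Finset.sum_apply, Finsupp.smul_apply, Finsupp.single_apply, smul_eq_mul,
    ← eq_sub_iff_add_eq]
  simp

theorem charpoly_lmul_diagonal {Γ : Type*} [Fintype Γ] [DecidableEq Γ]
    {B : Type*} [CommRing B] [Algebra R B] [Module.Free R B] [Module.Finite R B]
    (e : Module.Basis Γ R B) (he : ∀ a a', e a * e a' = if a = a' then e a else 0) (d : Γ → R) :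
    (Algebra.lmul R B (∑ a, d a • e a)).charpoly = (Matrix.diagonal d).charpoly := by
  rw [← LinearMap.charpoly_toMatrix _ e]
  congr 1
  ext a' a
  rw [LinearMap.toMatrix_apply]
  change e.repr ((∑ k, d k • e k) * e a) a' = Matrix.diagonal d a' a
  rw [Finset.sum_mul]
  simp only [smul_mul_assoc, he]
  by_cases h : a' = a
  · simp [h]
  · simp [h]

variable {p : ℕ} {B B' : Type*} [CommRing B] [Algebra R B] [CommRing B'] [Algebra R B']

theorem charpoly_lmul_baseChange_group [NeZero p] [Module.Free R B] [Module.Finite R B]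
    {b : Module.Basis (Gam p) R B}
    (hb : ∀ g g', b g * b g' = b (g + g')) (R' : Type*) [CommRing R'] [Algebra R R']
    (c : Gam p → R') :
    (Algebra.lmul R' (R' ⊗[R] B) (∑ g, c g ⊗ₜ b g)).charpoly =
      (Matrix.of fun g' g => c (g' - g)).charpoly := by
  rw [← charpoly_lmul_group (Algebra.TensorProduct.basis R' b)
    (fun g g' => by simp [Algebra.TensorProduct.basis_apply, hb])]
  simp [Algebra.TensorProduct.basis_apply, TensorProduct.smul_tmul']

theorem charpoly_lmul_baseChange_diagonal [NeZero p] [Module.Free R B'] [Module.Finite R B']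
    {b : Module.Basis (Gam p) R B}
    {e : Module.Basis (Gam p) R B'} (he : ∀ a a', e a * e a' = if a = a' then e a else 0)
    {χ : Gam p → Gam p → R} {φ : B →ₐ[R] B'} (hφ : ∀ g, φ (b g) = ∑ a, χ g a • e a)
    (R' : Type*) [CommRing R'] [Algebra R R'] (c : Gam p → R') :
    (Algebra.lmul R' (R' ⊗[R] B')
        (Algebra.TensorProduct.map (AlgHom.id R' R') φ (∑ g, c g ⊗ₜ b g))).charpoly =
      (Matrix.diagonal fun a => ∑ g, c g * algebraMap R R' (χ g a)).charpoly := by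
  rw [← charpoly_lmul_diagonal (Algebra.TensorProduct.basis R' e)
    (fun a a' => by
      simp only [Algebra.TensorProduct.basis_apply, Algebra.TensorProduct.tmul_mul_tmul, he,
        mul_one]
      split_ifs <;> simp)]
  congr 2
  simp only [map_sum, Algebra.TensorProduct.map_tmul, hφ, AlgHom.coe_id, id,
    Algebra.TensorProduct.basis_apply, TensorProduct.smul_tmul', smul_eq_mul, mul_one,
    TensorProduct.tmul_sum, TensorProduct.sum_tmul]
  rw [Finset.sum_comm]
  refine Finset.sum_congr rfl fun a _ => Finset.sum_congr rfl fun g _ => ?_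
  rw [← TensorProduct.smul_tmul, Algebra.smul_def, mul_comm]

theorem exists_eq_sum_tmul [NeZero p] (b : Module.Basis (Gam p) R B) {R' : Type*} [CommRing R']
    [Algebra R R'] (f : R' ⊗[R] B) : ∃ c : Gam p → R', f = ∑ g, c g ⊗ₜ b g := by
  refine ⟨(Algebra.TensorProduct.basis R' b).repr f, ?_⟩
  conv_lhs => rw [← (Algebra.TensorProduct.basis R' b).sum_repr f]
  simp [Algebra.TensorProduct.basis_apply, TensorProduct.smul_tmul']

/-- The characteristic matrix is itself a multiplication matrix over `R[X]`, for the element `X - c`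
of the group algebra; the determinant identity applies there. -/
theorem IsFullPairing.charpoly_eq [Fact p.Prime] {χ : Gam p → Gam p → R} (h : IsFullPairing χ)
    (c : Gam p → R) :
    (Matrix.of fun g' g => c (g' - g)).charpoly =
      (Matrix.diagonal fun a => ∑ g, c g * χ g a).charpoly := by
  rw [Matrix.charpoly_diagonal]
  have h1 := (h.map Polynomial.C).det_eq_prod
    (fun g => (if g = 0 then Polynomial.X else 0) - Polynomial.C (c g))
  rw [Matrix.charpoly]
  refine Eq.trans ?_ (h1.trans ?_)
  · congr 1
    ext1 g' g
    simp only [Matrix.charmatrix_apply, Matrix.of_apply, Matrix.diagonal_apply, sub_eq_zero]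
  · refine Finset.prod_congr rfl fun a _ => ?_
    simp only [sub_mul, Finset.sum_sub_distrib, ite_mul, zero_mul, Finset.sum_ite_eq',
      Finset.mem_univ, if_true, h.zero_left, map_one, mul_one, map_sum, map_mul]

end Charpoly

section TimesHom

variable {R : Type u} [CommRing R] {p : ℕ} [Fact p.Prime]
  {B B' : Type*} [CommRing B] [Algebra R B] [Module.Free R B] [Module.Finite R B]
  [CommRing B'] [Algebra R B'] [Module.Free R B'] [Module.Finite R B']
  {b : Module.Basis (Gam p) R B} {e : Module.Basis (Gam p) R B'} {χ : Gam p → Gam p → R}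
  {φ : B →ₐ[R] B'}

theorem IsFullPairing.isTimesHom (h : IsFullPairing χ) (hb : ∀ g g', b g * b g' = b (g + g'))
    (he : ∀ a a', e a * e a' = if a = a' then e a else 0)
    (hφ : ∀ g, φ (b g) = ∑ a, χ g a • e a) : IsTimesHom φ := by
  intro R' _ _ f
  obtain ⟨c, rfl⟩ := exists_eq_sum_tmul b f
  rw [charpoly_lmul_baseChange_group hb, charpoly_lmul_baseChange_diagonal he hφ]
  exact (h.map (algebraMap R R')).charpoly_eq c

/-- Compare traces for `f = b g`. Translation by `g ≠ 0` has no fixed point, so the trace on the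
group algebra is `0`; on the diagonal side it is the sum of the values. -/
theorem IsTimesHom.sum_eq_zero (h : IsTimesHom φ) (hb : ∀ g g', b g * b g' = b (g + g'))
    (he : ∀ a a', e a * e a' = if a = a' then e a else 0)
    (hφ : ∀ g, φ (b g) = ∑ a, χ g a • e a) {g : Gam p} (hg : g ≠ 0) : ∑ a, χ g a = 0 := by
  have h1 := h R (∑ k, (if k = g then (1 : R) else 0) ⊗ₜ b k)
  rw [charpoly_lmul_baseChange_group hb R fun k => if k = g then (1 : R) else 0,
    charpoly_lmul_baseChange_diagonal he hφ R fun k => if k = g then (1 : R) else 0] at h1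
  have h2 := congrArg (fun q => -Polynomial.nextCoeff q) h1
  simp only [← Matrix.trace_eq_neg_charpoly_nextCoeff] at h2
  simpa [Matrix.trace, hg.symm] using h2.symm

end TimesHom

/-! ### Group-like and idempotent bases of the coordinate rings and their Cartier duals -/

section Bases

variable {p : ℕ} {R : Type*} [CommRing R]

theorem muRing_basis_mul (g g' : Gam p) :
    AddMonoidAlgebra.basis (Gam p) R g * AddMonoidAlgebra.basis (Gam p) R g' =
      AddMonoidAlgebra.basis (Gam p) R (g + g') := by
  simp [AddMonoidAlgebra.single_mul_single]

variable [NeZero p]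

/-- The basis of indicator functions. -/
noncomputable def indBasis (p : ℕ) [NeZero p] (R : Type*) [CommRing R] :
    Module.Basis (Gam p) R (ConstRing R (Gam p)) :=
  Module.Basis.ofEquivFun
    { toFun := fun f a => ConstRing.ev a f
      map_add' := fun _ _ => rfl
      map_smul' := fun _ _ => rfl
      invFun := ConstRing.ofFun
      left_inv := fun _ => rfl
      right_inv := fun _ => rfl }

theorem indBasis_apply (a : Gam p) : indBasis p R a = ConstRing.ind a := by
  refine ConstRing.ext_ev fun x => ?_
  rw [indBasis, Module.Basis.coe_ofEquivFun, ConstRing.ev_ind]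
  exact Pi.single_apply a 1 x

theorem indBasis_mul (a a' : Gam p) :
    indBasis p R a * indBasis p R a' = if a = a' then indBasis p R a else 0 := by
  simp only [indBasis_apply, ConstRing.ind_mul, ConstRing.ev_ind]
  split_ifs <;> simp

theorem HomPt.apply_basis (h : HomPt p R) (g : Gam p) :
    h (AddMonoidAlgebra.basis (Gam p) R g) = ∑ a, h.val g a • indBasis p R a := by
  simp only [indBasis_apply]
  exact (ConstRing.sum_ev_smul_ind _).symm.trans (by simp [HomPt.val])

/-- The basis of the Cartier dual which is dual to a given basis. -/
noncomputable def cartierBasis {Γ B : Type*} [Finite Γ] [DecidableEq Γ] [CommRing B]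
    [Bialgebra R B] (b : Module.Basis Γ R B) : Module.Basis Γ R (CartierDual R B) :=
  b.dualBasis.map (WithConv.linearEquiv R (B →ₗ[R] R)).symm

theorem cartierBasis_ofConv {Γ B : Type*} [Finite Γ] [DecidableEq Γ] [CommRing B]
    [Bialgebra R B] (b : Module.Basis Γ R B) (g : Γ) (x : B) :
    (cartierBasis b g).ofConv x = b.repr x g := by
  change b.dualBasis g x = _
  simp

theorem cartierBasis_indBasis (a : Gam p) (f : ConstRing R (Gam p)) :
    (cartierBasis (indBasis p R) a).ofConv f = ConstRing.ev a f := by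
  rw [cartierBasis_ofConv]
  rfl

/-- The dual of the indicator of `a` is evaluation at `a`, and evaluations convolve by addition of
points. -/
theorem cartierBasis_indBasis_mul (a a' : Gam p) :
    cartierBasis (indBasis p R) a * cartierBasis (indBasis p R) a' =
      cartierBasis (indBasis p R) (a + a') := by
  refine WithConv.ofConv_injective (LinearMap.ext fun f => ?_)
  rw [LinearMap.convMul_apply, cartierBasis_indBasis, ConstRing.comul_apply, map_sum, map_sum]
  simp [cartierBasis_indBasis]

/-- Monomials are group-like, so convolution of functionals is pointwise multiplication of their
values on monomials. -/
theorem cartierBasis_muRing_mul (g g' : Gam p) :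
    cartierBasis (AddMonoidAlgebra.basis (Gam p) R) g *
        cartierBasis (AddMonoidAlgebra.basis (Gam p) R) g' =
      if g = g' then cartierBasis (AddMonoidAlgebra.basis (Gam p) R) g else 0 := by
  refine WithConv.ofConv_injective
    ((AddMonoidAlgebra.basis (Gam p) R).ext fun k => ?_)
  rw [LinearMap.convMul_apply]
  have : comul (R := R) (AddMonoidAlgebra.basis (Gam p) R k) =
      AddMonoidAlgebra.basis (Gam p) R k ⊗ₜ AddMonoidAlgebra.basis (Gam p) R k := by
    simp
  rw [this, TensorProduct.map_tmul, LinearMap.mul'_apply, cartierBasis_ofConv,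
    cartierBasis_ofConv, Module.Basis.repr_self]
  split_ifs with h
  · rw [cartierBasis_ofConv, Module.Basis.repr_self]
    subst h
    by_cases h1 : k = g <;> simp [h1]
  · by_cases h1 : k = g
    · subst h1
      simp [h]
    · simp [h1]

theorem cartierDualHom_basis (h : HomPt p R) (a : Gam p) :
    cartierDualHom h (cartierBasis (indBasis p R) a) =
      ∑ g, h.val g a • cartierBasis (AddMonoidAlgebra.basis (Gam p) R) g := by
  refine WithConv.ofConv_injective
    ((AddMonoidAlgebra.basis (Gam p) R).ext fun k => ?_)
  have h1 : (cartierDualHom h (cartierBasis (indBasis p R) a)).ofConv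
      (AddMonoidAlgebra.basis (Gam p) R k) = h.val k a := by
    change (cartierBasis (indBasis p R) a).ofConv (h (AddMonoidAlgebra.basis (Gam p) R k)) = _
    rw [cartierBasis_indBasis, AddMonoidAlgebra.basis_apply]
    rfl
  rw [h1]
  have h2 : (WithConv.linearEquiv R _ (∑ g, h.val g a •
      cartierBasis (AddMonoidAlgebra.basis (Gam p) R) g)) (AddMonoidAlgebra.basis (Gam p) R k) =
      ∑ g, h.val g a *
        (cartierBasis (AddMonoidAlgebra.basis (Gam p) R) g).ofConv
          (AddMonoidAlgebra.basis (Gam p) R k) := by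
    rw [map_sum, LinearMap.sum_apply]
    rfl
  refine Eq.trans ?_ h2.symm
  simp only [cartierBasis_ofConv, Module.Basis.repr_self, Finsupp.single_apply]
  simp

end Bases

/-! ### Comparison of the two closed conditions -/

section KMD

variable {p : ℕ} [Fact p.Prime]

/-- The dual homomorphism has the same form as `h`, with the two arguments of the pairing exchanged.
Each `×`-condition yields one family of orthogonality relations, while each converse uses both
families. -/
theorem isKMD_iff {R : Type u} [CommRing R] (h : HomPt p R) : IsKMD h ↔ IsFullPairing h.val := by
  constructor
  · rintro ⟨h1, h2⟩
    exact ⟨h.val_zero_left, h.val_add_left, h.val_zero_right, h.val_add_right,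
      fun a ha => h2.sum_eq_zero (χ := fun a g => h.val g a) cartierBasis_indBasis_mul
        cartierBasis_muRing_mul (cartierDualHom_basis h) ha,
      fun g hg => h1.sum_eq_zero muRing_basis_mul indBasis_mul h.apply_basis hg⟩
  · intro H
    exact ⟨H.isTimesHom muRing_basis_mul indBasis_mul h.apply_basis,
      H.symm.isTimesHom cartierBasis_indBasis_mul cartierBasis_muRing_mul
        (cartierDualHom_basis h)⟩

theorem sum_pow_val {R : Type*} [CommRing R] (x : R) : ∑ k : ZMod p, x ^ k.val = Phi p x :=
  Finset.sum_nbij' (fun k : ZMod p => k.val) (fun n => (n : ZMod p))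
    (fun k _ => Finset.mem_range.2 k.val_lt) (fun _ _ => Finset.mem_univ _)
    (fun k _ => ZMod.natCast_zmod_val k)
    (fun _ hn => ZMod.val_cast_of_lt (Finset.mem_range.1 hn)) (fun _ _ => rfl)

theorem HomPt.sum_val_left {R : Type*} [CommRing R] (h : HomPt p R) (a : Gam p) :
    ∑ g, h.val g a = primEq p (h.val (1, 0) a) (h.val (0, 1) a) := by
  rw [primEq, ← sum_pow_val, ← sum_pow_val, Finset.sum_mul_sum, Fintype.sum_prod_type]
  refine Finset.sum_congr rfl fun i _ => Finset.sum_congr rfl fun j _ => ?_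
  have h2 := h.val_nsmul (1, 0) a i.val 1
  have h3 := h.val_nsmul (0, 1) a j.val 1
  rw [one_mul, one_smul] at h2 h3
  rw [← h2, ← h3, ← h.val_add_left]
  simp

theorem HomPt.sum_val_right {R : Type*} [CommRing R] (h : HomPt p R) (g : Gam p) :
    ∑ a, h.val g a = primEq p (h.val g (1, 0)) (h.val g (0, 1)) := by
  rw [primEq, ← sum_pow_val, ← sum_pow_val, Finset.sum_mul_sum, Fintype.sum_prod_type]
  refine Finset.sum_congr rfl fun i _ => Finset.sum_congr rfl fun j _ => ?_
  have h2 := h.val_nsmul g (1, 0) 1 i.val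
  have h3 := h.val_nsmul g (0, 1) 1 j.val
  rw [mul_one, one_smul] at h2 h3
  rw [← h2, ← h3, ← h.val_add_right]
  simp

theorem sum_univHom_val_left (a : Gam p) : ∑ g, (univHom p).val g a =
    primEq p (entry p 0 0 ^ a.1.val * entry p 1 0 ^ a.2.val)
      (entry p 0 1 ^ a.1.val * entry p 1 1 ^ a.2.val) := by
  rw [HomPt.sum_val_left]
  simp [univHom, HomPt.ofMatrix]

theorem sum_univHom_val_right (g : Gam p) : ∑ a, (univHom p).val g a =
    primEq p (entry p 0 0 ^ g.1.val * entry p 0 1 ^ g.2.val)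
      (entry p 1 0 ^ g.1.val * entry p 1 1 ^ g.2.val) := by
  rw [HomPt.sum_val_right]
  simp [univHom, HomPt.ofMatrix]

theorem fullIdeal_le_ker_iff {R : Type u} [CommRing R] (φ : CoordRing p →+* R) :
    fullIdeal p ≤ RingHom.ker φ ↔ IsKMD ((univHom p).map φ) := by
  have hv (g a : Gam p) : ((univHom p).map φ).val g a = φ ((univHom p).val g a) := by
    simp [HomPt.map]
  rw [isKMD_iff]
  constructor
  · intro h
    refine ⟨HomPt.val_zero_left _, HomPt.val_add_left _, HomPt.val_zero_right _,
      HomPt.val_add_right _, fun a ha => ?_, fun g hg => ?_⟩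
    · simp only [hv, ← map_sum]
      rw [sum_univHom_val_left]
      exact h (Ideal.subset_span (Or.inl ⟨a, ha, rfl⟩))
    · simp only [hv, ← map_sum]
      rw [sum_univHom_val_right]
      exact h (Ideal.subset_span (Or.inr ⟨g, hg, rfl⟩))
  · intro h
    refine Ideal.span_le.2 ?_
    rintro _ (⟨a, ha, rfl⟩ | ⟨g, hg, rfl⟩)
    · have := h.sum_left a ha
      simp only [hv, ← map_sum] at this
      rwa [sum_univHom_val_left] at this
    · have := h.sum_right g hg
      simp only [hv, ← map_sum] at this
      rwa [sum_univHom_val_right] at this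

/-- The ideals over which the universal homomorphism satisfies the condition are exactly those
containing `fullIdeal p`, so the infimum is attained there. -/
theorem kmdIdeal_eq_fullIdeal : kmdIdeal p = fullIdeal p := by
  have : {J | IsKMD ((univHom p).map (Ideal.Quotient.mk J))} = Set.Ici (fullIdeal p) := by
    ext J
    rw [Set.mem_ofPred_eq, ← fullIdeal_le_ker_iff, Ideal.mk_ker, Set.mem_Ici]
  rw [kmdIdeal, this, csInf_Ici]

end KMD

end FullLevel

theorem theorem2 (p : ℕ) [Fact p.Prime] :
    (∀ (R : Type u) [CommRing R] (φ : FullLevel.CoordRing p →+* R),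
      FullLevel.kmdIdeal p ≤ RingHom.ker φ ↔
        FullLevel.IsKMD ((FullLevel.univHom p).map φ)) ∧
    FullLevel.HomKMD p = FullLevel.HomFull p := by
  refine ⟨fun R _ φ => ?_, ?_⟩
  · rw [FullLevel.kmdIdeal_eq_fullIdeal, FullLevel.fullIdeal_le_ker_iff]
  · rw [FullLevel.HomKMD, FullLevel.HomFull, FullLevel.kmdIdeal_eq_fullIdeal]
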